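/- Let $H\in(0,1)$, $\theta>0$, $\mu\in\mathbb R$, and put $\alpha=\mu\theta$. Let $B^H=\{B^H_t,\ t\ge 0\}$ be a fractional Brownian motion with Hurst parameter $H$ on a probability space $(\Omega,P)$, i.e. a centered Gaussian process with continuous paths, starting from zero, with $E(B^H_sB^H_t)=\frac12\left(s^{2H}+t^{2H}-|s-t|^{2H}\right)$, and let $X$ be the continuous pathwise solution of $$X_0=0,\qquad dX_t=\theta(\mu+X_t)\,dt+dB^H_t,\quad t\ge 0,$$ that is, $X_t=\int_0^t\theta(\mu+X_s)\,ds+B^H_t$ for all $t\ge 0$. For $T>0$ define $$\widetilde\theta_T=\frac{\frac12TX_T^2-X_T\int_0^TX_s\,ds}{T\int_0^TX_s^2\,ds-\left(\int_0^TX_s\,ds\right)^2},\qquad \widetilde\alpha_T=\frac{X_T\int_0^TX_s^2\,ds-\frac12X_T^2\int_0^TX_s\,ds}{T\int_0^TX_s^2\,ds-\left(\int_0^TX_s\,ds\right)^2},$$ $$\widetilde\mu_T=\frac{\int_0^TX_s^2\,ds-\frac12X_T\int_0^TX_s\,ds}{\frac12TX_T-\int_0^TX_s\,ds}.$$ Then,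 almost surely, as $T\to\infty$, $$(\widetilde\theta_T,\widetilde\mu_T)\to(\theta,\mu),\qquad(\widetilde\theta_T,\widetilde\alpha_T)\to(\theta,\alpha).$$ Let moreover $\zeta_\infty=\theta\int_0^\infty e^{-\theta s}B^H_s\,ds$ and $\sigma^2=H\Gamma(2H)/\theta^{2H}$ with $\sigma>0$. The integral converges absolutely almost surely, and $\zeta_\infty\sim\mathcal N(0,\sigma^2)$. If $N_1\sim\mathcal N(0,1)$, $N_2\sim\mathcal N(0,1)$ and $B^H$ are independent, where $N_1,N_2$ are defined on $(\Omega,P)$ or on an extension of it, then $\zeta_\infty,N_1,N_2$ are independent, and, as $T\to\infty$, $$\left(e^{\theta T}(\widetilde\theta_T-\theta),\,T^{1-H}(\widetilde\mu_T-\mu)\right)\overset{\mathrm{Law}}{\longrightarrow}\left(\frac{2\theta\sigma N_2}{\mu+\zeta_\infty},\,\frac1\theta N_1\right),$$ $$\left(e^{\theta T}(\widetilde\theta_T-\theta),\,T^{1-H}(\widetilde\alpha_T-\alpha)\right)\overset{\mathrm{Law}}{\longrightarrow}\left(\frac{2\theta\sigma N_2}{\mu+\zeta_\infty},\,N_1\right).$$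 -/

import Mathlib

open MeasureTheory ProbabilityTheory Filter Set
open scoped Topology NNReal

namespace FractionalVasicek

/-- `B` is a fractional Brownian motion with Hurst parameter `H` under `P`: a centered Gaussian
process indexed by `[0, ∞)`, starting from zero, with covariance
`(s ^ (2 H) + t ^ (2 H) - |s - t| ^ (2 H)) / 2`, taken with (almost surely) continuous paths. -/
structure IsFractionalBrownianMotion {Ω : Type*} [MeasurableSpace Ω] (H : ℝ)
    (B : ℝ≥0 → Ω → ℝ) (P : Measure Ω) : Prop where
  isGaussianProcess : IsGaussianProcess B P
  centered : ∀ t, ∫ ω, B t ω ∂P = 0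
  covariance : ∀ s t : ℝ≥0, ∫ ω, B s ω * B t ω ∂P =
    (1 / 2) * ((s : ℝ) ^ (2 * H) + (t : ℝ) ^ (2 * H) - |(s : ℝ) - (t : ℝ)| ^ (2 * H))
  start_zero : ∀ᵐ ω ∂P, B 0 ω = 0
  continuous_paths : ∀ᵐ ω ∂P, Continuous fun t => B t ω

/-- `X` is the pathwise solution of `X_0 = 0`, `dX_t = θ (μ + X_t) dt + dG_t`: almost surely the
path of `X` is continuous, starts at zero, and satisfies the integrated equation at all times. -/
def IsVasicekSolution {Ω : Type*} [MeasurableSpace Ω] (θ μ : ℝ)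
    (G X : ℝ≥0 → Ω → ℝ) (P : Measure Ω) : Prop :=
  ∀ᵐ ω ∂P, (Continuous fun t => X t ω) ∧ X 0 ω = 0 ∧
    ∀ t : ℝ≥0, X t ω = (∫ s in (0 : ℝ)..t, θ * (μ + X s.toNNReal ω)) + G t ω

/-- `∫_0^T x_s ds` for a path `x` on `[0, ∞)`. -/
noncomputable def pathIntegral (x : ℝ≥0 → ℝ) (T : ℝ≥0) : ℝ :=
  ∫ s in (0 : ℝ)..T, x s.toNNReal

/-- `∫_0^T x_s ^ 2 ds` for a path `x` on `[0, ∞)`. -/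
noncomputable def pathSqIntegral (x : ℝ≥0 → ℝ) (T : ℝ≥0) : ℝ :=
  ∫ s in (0 : ℝ)..T, x s.toNNReal ^ 2

/-- The least squares-type estimator of `θ` from the observed path `x` on `[0, T]`. -/
noncomputable def thetaEst (x : ℝ≥0 → ℝ) (T : ℝ≥0) : ℝ :=
  ((1 / 2) * T * x T ^ 2 - x T * pathIntegral x T) /
    (T * pathSqIntegral x T - pathIntegral x T ^ 2)

/-- The least squares-type estimator of `α = μ θ` from the observed path `x` on `[0, T]`. -/
noncomputable def alphaEst (x : ℝ≥0 → ℝ) (T : ℝ≥0) : ℝ :=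
  (x T * pathSqIntegral x T - (1 / 2) * x T ^ 2 * pathIntegral x T) /
    (T * pathSqIntegral x T - pathIntegral x T ^ 2)

/-- The least squares-type estimator of `μ` from the observed path `x` on `[0, T]`. -/
noncomputable def muEst (x : ℝ≥0 → ℝ) (T : ℝ≥0) : ℝ :=
  (pathSqIntegral x T - (1 / 2) * x T * pathIntegral x T) /
    ((1 / 2) * T * x T - pathIntegral x T)

/-- Where no denominator vanishes, the estimator of `μ` is the quotient of those of `α`, `θ`. -/
theorem muEst_eq_div (x : ℝ≥0 → ℝ) (T : ℝ≥0) (hx : x T ≠ 0)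
    (hD : T * pathSqIntegral x T - pathIntegral x T ^ 2 ≠ 0) :
    muEst x T = alphaEst x T / thetaEst x T := by
  unfold muEst alphaEst thetaEst
  rw [div_div_div_cancel_right₀ hD, ← mul_div_mul_left _ _ hx]
  congr 1 <;> ring

/-- `ζ_∞ = θ ∫_0^∞ e ^ (-θ s) G_s ds`. -/
noncomputable def zetaInf {Ω : Type*} (θ : ℝ) (G : ℝ≥0 → Ω → ℝ) (ω : Ω) : ℝ :=
  θ * ∫ s in Ioi (0 : ℝ), Real.exp (-θ * s) * G s.toNNReal ω

/-- The limiting variance `σ ^ 2 = H Γ(2 H) / θ ^ (2 H)`. -/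
noncomputable def sigmaSq (H θ : ℝ) : ℝ := H * Real.Gamma (2 * H) / θ ^ (2 * H)

end FractionalVasicek

namespace FractionalVasicek

/-! ### Exponentially weighted integrals and paths of sublinear growth. -/

section Deterministic

open Real

/-! The argument separates a pathwise expansion from a Gaussian limit theorem.

Pathwise, let `b` be a continuous noise path with `b t / t → 0`, and put `M = μ + ζ_∞`. Variation of
constants gives `x t = M e ^ (θ t) + O(e ^ (δ t))` for every `0 < δ < θ`, so if `M ≠ 0` the
denominators have an exact order; for instance `pathDisc` is asymptotic to `M ^ 2 T e ^ (2 θ T) / (2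
θ)`. As `y = x - b` is continuously differentiable, integrating `y'` and `y y'` gives exact
identities for `∫ x` and `∫ x ^ 2` without any stochastic integral. They express the errors of the
estimators through one bracket, asymptotic to `e ^ (θ T) M Z_T` (`tendsto_bracket`). Hence `e ^ (θ
T) (θ̂ - θ) ≈ 2 θ Z_T / M`, while `T (μ̂ - μ)` is `b_T / θ` to leading order, plus a bounded
multiple of `Z_T / M`. Consistency follows from `b_T / T → 0` and `Z_T / T → 0`; the estimator of
`α` is eventually the product of the other two.

These expansions apply almost surely: moment bounds and dyadic chaining show that fractional
Brownian motion is sublinear (`ae_sublinear`), and `ζ_∞` has a nondegenerate Gaussian law, so `M ≠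
0`.

In law, after scaling by `T ^ (-H)` the `Z_T` term of the second error disappears, and the joint
limit of `(ζ_∞, Z_T, T ^ (-H) B_T)` is needed. Against the exponential law of rate `θ`, `ζ_∞` is the
mean of `B_s` and `Z_T` the mean of `B_T - B_{(T - s)⁺}`. Every linear combination of the three is
thus the integral of one Gaussian process (`mixedNoise`), hence centred Gaussian with variance the
double integral of a covariance. Three facts give the limit of that covariance: increments are
stationary, increments near `T` decorrelate from the values at fixed times, and `T ^ (-H) B_T`
decorrelates from both. Cramér–Wold, continuous mapping and Slutsky finish the proof. -/

lemma exists_bound_of_tendsto {g : ℝ → ℝ} (hg : Continuous g) {l : ℝ}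
    (h : Tendsto g atTop (𝓝 l)) : ∃ C, 0 ≤ C ∧ ∀ t, 0 ≤ t → |g t| ≤ C := by
  have h1 : ∀ᶠ t in atTop, |g t| < |l| + 1 :=
    (h.abs).eventually (gt_mem_nhds (by linarith))
  obtain ⟨T₀, hT₀⟩ := eventually_atTop.1 h1
  obtain ⟨C, hC⟩ := (isCompact_Icc (a := (0 : ℝ)) (b := T₀)).exists_bound_of_continuousOn
    hg.continuousOn
  refine ⟨max C (|l| + 1), le_max_of_le_right (by positivity), fun t ht => ?_⟩
  rcases le_total t T₀ with h' | h'
  · exact le_max_of_le_left (by simpa using hC t ⟨ht, h'⟩)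
  · exact le_max_of_le_right (hT₀ t h').le

lemma integrableOn_exp_neg_mul_Ioi {a : ℝ} (ha : 0 < a) (c : ℝ) :
    IntegrableOn (fun u : ℝ => exp (-a * u)) (Ioi c) :=
  exp_neg_integrableOn_Ioi c ha

lemma integral_exp_neg_mul_Ioi {a : ℝ} (ha : 0 < a) (c : ℝ) :
    ∫ u in Ioi c, exp (-a * u) = exp (-a * c) / a := by
  rw [integral_exp_mul_Ioi (by linarith) c]
  field_simp

/-- If `e ^ (-a t) f t` has a limit, so has `e ^ (-a T) ∫_0^T f`. -/
lemma tendsto_exp_neg_mul_integral {f : ℝ → ℝ} (hf : Continuous f) {a l : ℝ} (ha : 0 < a)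
    (h : Tendsto (fun t => exp (-a * t) * f t) atTop (𝓝 l)) :
    Tendsto (fun T => exp (-a * T) * ∫ s in (0 : ℝ)..T, f s) atTop (𝓝 (l / a)) := by
  set g : ℝ → ℝ := fun t => exp (-a * t) * f t with hg_def
  have hg : Continuous g := by fun_prop
  obtain ⟨C, hC0, hC⟩ := exists_bound_of_tendsto hg h
  -- Reversing time by `s = T - u` gives the integral of `e ^ (-a u) g (T - u)` over `u ≤ T`. With
  -- the indicator the domain no longer depends on `T`, and `C e ^ (-a u)` dominates.
  have key : ∀ᶠ T in atTop, (∫ u in Ioi (0 : ℝ), (Iic T).indicator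
      (fun u => exp (-a * u) * g (T - u)) u) = exp (-a * T) * ∫ s in (0 : ℝ)..T, f s := by
    filter_upwards [eventually_ge_atTop 0] with T hT
    rw [integral_indicator measurableSet_Iic, Measure.restrict_restrict measurableSet_Iic,
      show Iic T ∩ Ioi 0 = Ioc 0 T by ext; simp [and_comm],
      ← intervalIntegral.integral_of_le hT, ← intervalIntegral.integral_const_mul]
    have := intervalIntegral.integral_comp_sub_left
      (a := 0) (b := T) (fun s => exp (-a * T) * f s) T
    simp only [sub_self, sub_zero] at this
    rw [← this]
    refine intervalIntegral.integral_congr fun u _ => ?_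
    simp only [hg_def, ← mul_assoc, ← exp_add]
    ring_nf
  refine Tendsto.congr' key ?_
  have hlim : l / a = ∫ u in Ioi (0 : ℝ), exp (-a * u) * l := by
    rw [integral_mul_const, integral_exp_neg_mul_Ioi ha]
    simp
    ring
  rw [hlim]
  refine tendsto_integral_filter_of_dominated_convergence (fun u => exp (-a * u) * C) ?_ ?_ ?_ ?_
  · refine Eventually.of_forall fun T => ?_
    exact ((by fun_prop : Measurable fun u => exp (-a * u) * g (T - u)).indicator
      measurableSet_Iic).aestronglyMeasurable
  · refine Eventually.of_forall fun T => ?_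
    refine (ae_restrict_mem measurableSet_Ioi).mono fun u _ => ?_
    by_cases hu : u ≤ T
    · rw [indicator_of_mem (by exact hu), norm_mul, norm_eq_abs, abs_exp]
      exact mul_le_mul_of_nonneg_left (hC _ (by linarith)) (exp_pos _).le
    · rw [indicator_of_notMem (by exact hu)]
      simp only [norm_zero]
      positivity
  · exact (integrableOn_exp_neg_mul_Ioi ha 0).mul_const C
  · refine Eventually.of_forall fun u => ?_
    have h1 : Tendsto (fun T => exp (-a * u) * g (T - u)) atTop (𝓝 (exp (-a * u) * l)) :=
      (h.comp (tendsto_atTop_add_const_right _ (-u) tendsto_id)).const_mul _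
    refine h1.congr' ?_
    filter_upwards [eventually_ge_atTop u] with T hT
    rw [indicator_of_mem (by exact hT)]

/-- A path of sublinear growth is dominated by every exponential. -/
lemma tendsto_exp_neg_mul_of_sublinear {b : ℝ → ℝ}
    (hb : Tendsto (fun t => b t / t) atTop (𝓝 0)) {δ : ℝ} (hδ : 0 < δ) :
    Tendsto (fun t => exp (-δ * t) * b t) atTop (𝓝 0) := by
  have h1 : Tendsto (fun t : ℝ => t ^ (1 : ℝ) * exp (-δ * t)) atTop (𝓝 0) :=
    tendsto_rpow_mul_exp_neg_mul_atTop_nhds_zero 1 δ hδ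
  have := hb.mul h1
  rw [zero_mul] at this
  refine this.congr' ?_
  filter_upwards [eventually_gt_atTop 0] with t ht
  rw [rpow_one]
  field_simp

lemma exists_exp_bound_of_sublinear {b : ℝ → ℝ} (hbc : Continuous b)
    (hb : Tendsto (fun t => b t / t) atTop (𝓝 0)) {δ : ℝ} (hδ : 0 < δ) :
    ∃ C, 0 ≤ C ∧ ∀ t, 0 ≤ t → |b t| ≤ C * exp (δ * t) := by
  obtain ⟨C, hC0, hC⟩ := exists_bound_of_tendsto (by fun_prop)
    (tendsto_exp_neg_mul_of_sublinear hb hδ)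
  refine ⟨C, hC0, fun t ht => ?_⟩
  have := hC t ht
  rw [abs_mul, abs_exp, neg_mul, exp_neg, inv_mul_le_iff₀ (exp_pos _)] at this
  linarith

lemma integrableOn_exp_neg_mul_of_sublinear {b : ℝ → ℝ} (hbc : Continuous b)
    (hb : Tendsto (fun t => b t / t) atTop (𝓝 0)) {θ : ℝ} (hθ : 0 < θ) :
    IntegrableOn (fun s => exp (-θ * s) * b s) (Ioi 0) := by
  obtain ⟨C, hC0, hC⟩ := exists_exp_bound_of_sublinear hbc hb (half_pos hθ)
  refine Integrable.mono' ((integrableOn_exp_neg_mul_Ioi (half_pos hθ) 0).mul_const C)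
    (by fun_prop) ?_
  refine (ae_restrict_mem measurableSet_Ioi).mono fun s hs => ?_
  rw [norm_mul, norm_eq_abs, norm_eq_abs, abs_exp]
  calc exp (-θ * s) * |b s| ≤ exp (-θ * s) * (C * exp (θ / 2 * s)) := by
        gcongr
        exact hC s (le_of_lt hs)
    _ = exp (-(θ / 2) * s) * C := by
        rw [mul_left_comm, ← exp_add, mul_comm]
        ring_nf

end Deterministic

/-! ### The explicit solution, its exponential growth, and two integral identities. -/

section Deterministic

open Real

/-- The integrated Vasicek equation `dx = θ (μ + x) dt + db` for paths on the real line. -/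
def SolvesVasicek (θ μ : ℝ) (b x : ℝ → ℝ) : Prop :=
  ∀ t, 0 ≤ t → x t = (∫ s in (0 : ℝ)..t, θ * (μ + x s)) + b t

/-- The explicit solution of the Vasicek equation driven by `b`. -/
noncomputable def vasicekPath (θ μ : ℝ) (b : ℝ → ℝ) (t : ℝ) : ℝ :=
  μ * (exp (θ * t) - 1) + b t + θ * exp (θ * t) * ∫ s in (0 : ℝ)..t, exp (-θ * s) * b s

lemma hasDerivAt_integral_of_continuous {f : ℝ → ℝ} (hf : Continuous f) (t : ℝ) :
    HasDerivAt (fun u => ∫ s in (0 : ℝ)..u, f s) (f t) t :=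
  intervalIntegral.integral_hasDerivAt_right (hf.intervalIntegrable _ _)
    (hf.stronglyMeasurableAtFilter _ _) hf.continuousAt

lemma hasDerivAt_exp_mul (a t : ℝ) : HasDerivAt (fun u => exp (a * u)) (exp (a * t) * a) t := by
  simpa using ((hasDerivAt_id t).const_mul a).exp

variable {θ μ : ℝ} {b x : ℝ → ℝ}

lemma SolvesVasicek.eq_vasicekPath (hb : Continuous b) (hx : Continuous x)
    (h : SolvesVasicek θ μ b x) {t : ℝ} (ht : 0 ≤ t) : x t = vasicekPath θ μ b t := by
  set y : ℝ → ℝ := fun t => ∫ s in (0 : ℝ)..t, θ * (μ + x s) with hy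
  have hy' : ∀ t, HasDerivAt y (θ * (μ + x t)) t := fun t =>
    hasDerivAt_integral_of_continuous (by fun_prop) t
  set J : ℝ → ℝ := fun t => ∫ s in (0 : ℝ)..t, exp (-θ * s) * b s with hJ
  have hJ' : ∀ t, HasDerivAt J (exp (-θ * t) * b t) t := fun t =>
    hasDerivAt_integral_of_continuous (by fun_prop) t
  -- A first integral of `y' = θ (μ + y + b)`. Only `y = x - b` is differentiated, so no regularity
  -- of `b` beyond continuity is used.
  set h0 : ℝ → ℝ := fun t => exp (-θ * t) * y t - θ * J t + μ * exp (-θ * t) with hh0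
  have hd : ∀ t, HasDerivAt h0 (exp (-θ * t) * -θ * y t + exp (-θ * t) * (θ * (μ + x t))
      - θ * (exp (-θ * t) * b t) + μ * (exp (-θ * t) * -θ)) t := fun t =>
    ((((hasDerivAt_exp_mul (-θ) t).mul (hy' t)).sub ((hJ' t).const_mul θ)).add
      ((hasDerivAt_exp_mul (-θ) t).const_mul μ))
  have hconst := constant_of_has_deriv_right_zero (f := h0) (a := 0) (b := t)
    (fun s _ => (hd s).continuousAt.continuousWithinAt) (fun s hs => by
      have := (hd s).hasDerivWithinAt (s := Ici s)
      convert this using 1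
      have hs' := h s hs.1
      rw [show y s = x s - b s by rw [hs']; ring]
      ring)
  have h1 := hconst t ⟨ht, le_rfl⟩
  simp only [hh0, hy, hJ, intervalIntegral.integral_same, mul_zero, exp_zero, mul_one,
    sub_zero, zero_add] at h1
  have h2 := h t ht
  have hE : exp (θ * t) * exp (-θ * t) = 1 := by rw [← exp_add]; simp
  rw [h2, vasicekPath]
  linear_combination exp (θ * t) * h1 -
    ((∫ s in (0 : ℝ)..t, θ * (μ + x s)) + μ) * hE

lemma SolvesVasicek.integral_eq (hx : Continuous x) (h : SolvesVasicek θ μ b x) {t : ℝ}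
    (ht : 0 ≤ t) : x t = θ * μ * t + θ * (∫ s in (0 : ℝ)..t, x s) + b t := by
  rw [h t ht, intervalIntegral.integral_const_mul,
    intervalIntegral.integral_add (by simp) (hx.intervalIntegrable _ _)]
  simp
  ring

/-- The energy identity: integrate `y y'` for `y = x - b`, with `y' = θ (μ + x)`, and expand the
product. It plays the role of the chain rule for `x ^ 2`. -/
lemma SolvesVasicek.integral_sq_eq (hb : Continuous b) (hx : Continuous x)
    (h : SolvesVasicek θ μ b x) {t : ℝ} (ht : 0 ≤ t) :
    θ * (∫ s in (0 : ℝ)..t, x s ^ 2) = (1 / 2) * (x t - b t) ^ 2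
      - θ * μ * (∫ s in (0 : ℝ)..t, x s) + θ * μ * (∫ s in (0 : ℝ)..t, b s)
      + θ * ∫ s in (0 : ℝ)..t, b s * x s := by
  set y : ℝ → ℝ := fun t => ∫ s in (0 : ℝ)..t, θ * (μ + x s) with hy
  have hy' : ∀ t, HasDerivAt y (θ * (μ + x t)) t := fun t =>
    hasDerivAt_integral_of_continuous (by fun_prop) t
  have hyc : Continuous y := continuous_iff_continuousAt.2 fun t => (hy' t).continuousAt
  have hd : ∀ t, HasDerivAt (fun t => (1 / 2) * y t ^ 2) (y t * (θ * (μ + x t))) t := fun t =>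
    (((hy' t).fun_pow 2).const_mul (1 / 2 : ℝ)).congr_deriv (by
      rw [show (2 : ℕ) - 1 = 1 from rfl]
      push_cast
      ring)
  have h1 := intervalIntegral.integral_eq_sub_of_hasDerivAt (a := 0) (b := t)
    (fun s _ => hd s) (Continuous.intervalIntegrable (by fun_prop) _ _)
  have hy0 : y 0 = 0 := by simp [hy]
  have hyt : y t = x t - b t := by rw [h t ht]; ring
  rw [hy0, hyt] at h1
  have h2 : ∫ s in (0 : ℝ)..t, y s * (θ * (μ + x s)) =
      ∫ s in (0 : ℝ)..t, (θ * x s ^ 2 + θ * μ * x s - θ * μ * b s - θ * (b s * x s)) := by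
    refine intervalIntegral.integral_congr fun s hs => ?_
    rw [uIcc_of_le ht] at hs
    have := h s hs.1
    rw [show y s = x s - b s by rw [this]; ring]
    ring
  rw [h2, intervalIntegral.integral_sub, intervalIntegral.integral_sub,
    intervalIntegral.integral_add] at h1
  · simp only [intervalIntegral.integral_const_mul] at h1
    linarith
  all_goals exact Continuous.intervalIntegrable (by fun_prop) _ _

/-- The remainder `x t - M e ^ (θ t)`, of subexponential growth. -/
lemma exists_exp_bound_vasicekPath_sub (hθ : 0 < θ) (hb : Continuous b)
    (hbt : Tendsto (fun t => b t / t) atTop (𝓝 0)) {δ : ℝ} (hδ : 0 < δ) (hδθ : δ < θ) :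
    ∃ C, 0 ≤ C ∧ ∀ t, 0 ≤ t → |vasicekPath θ μ b t -
      (μ + θ * ∫ s in Ioi (0 : ℝ), exp (-θ * s) * b s) * exp (θ * t)| ≤ C * exp (δ * t) := by
  obtain ⟨C, hC0, hC⟩ := exists_exp_bound_of_sublinear hb hbt hδ
  refine ⟨|μ| + C + θ * (C / (θ - δ)), by have := sub_pos.2 hδθ; positivity, fun t ht => ?_⟩
  have hint := integrableOn_exp_neg_mul_of_sublinear hb hbt hθ
  have hsplit : ∫ s in Ioi (0 : ℝ), exp (-θ * s) * b s =
      (∫ s in (0 : ℝ)..t, exp (-θ * s) * b s) + ∫ s in Ioi t, exp (-θ * s) * b s := by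
    rw [intervalIntegral.integral_of_le ht, ← setIntegral_union (by simp) measurableSet_Ioi
      (hint.mono_set Ioc_subset_Ioi_self) (hint.mono_set (Ioi_subset_Ioi ht)),
      Ioc_union_Ioi_eq_Ioi ht]
  have htail : |∫ s in Ioi t, exp (-θ * s) * b s| ≤ C * (exp (-(θ - δ) * t) / (θ - δ)) := by
    rw [← integral_exp_neg_mul_Ioi (sub_pos.2 hδθ), ← integral_const_mul, ← norm_eq_abs]
    refine norm_integral_le_of_norm_le
      ((integrableOn_exp_neg_mul_Ioi (sub_pos.2 hδθ) t).const_mul C) ?_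
    refine (ae_restrict_mem measurableSet_Ioi).mono fun s hs => ?_
    rw [norm_mul, norm_eq_abs, norm_eq_abs, abs_exp]
    calc exp (-θ * s) * |b s| ≤ exp (-θ * s) * (C * exp (δ * s)) := by
          gcongr
          exact hC s (ht.trans (le_of_lt hs))
      _ = C * exp (-(θ - δ) * s) := by
          rw [mul_left_comm, ← exp_add]
          ring_nf
  have heq : vasicekPath θ μ b t -
      (μ + θ * ∫ s in Ioi (0 : ℝ), exp (-θ * s) * b s) * exp (θ * t) =
      -μ + b t - θ * (exp (θ * t) * ∫ s in Ioi t, exp (-θ * s) * b s) := by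
    rw [hsplit, vasicekPath]
    ring
  have h1 : 1 ≤ exp (δ * t) := one_le_exp (by positivity)
  have h2 : |exp (θ * t) * ∫ s in Ioi t, exp (-θ * s) * b s| ≤ C / (θ - δ) * exp (δ * t) := by
    rw [abs_mul, abs_exp]
    calc exp (θ * t) * |∫ s in Ioi t, exp (-θ * s) * b s|
        ≤ exp (θ * t) * (C * (exp (-(θ - δ) * t) / (θ - δ))) := by gcongr
      _ = C / (θ - δ) * (exp (θ * t) * exp (-(θ - δ) * t)) := by ring
      _ = C / (θ - δ) * exp (δ * t) := by
          rw [← exp_add]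
          ring_nf
  rw [heq]
  calc |-μ + b t - θ * (exp (θ * t) * ∫ s in Ioi t, exp (-θ * s) * b s)|
      ≤ |-μ| + |b t| + |θ * (exp (θ * t) * ∫ s in Ioi t, exp (-θ * s) * b s)| :=
        (abs_sub _ _).trans (add_le_add_left (abs_add_le _ _) _)
    _ ≤ |μ| * exp (δ * t) + C * exp (δ * t) + θ * (C / (θ - δ) * exp (δ * t)) := by
        rw [abs_neg, abs_mul θ, abs_of_pos hθ]
        gcongr
        · exact le_mul_of_one_le_right (abs_nonneg _) h1
        · exact hC t ht
    _ = _ := by ring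

lemma tendsto_zero_of_exp_bound {f : ℝ → ℝ} {a δ C : ℝ} (hδ : δ < a)
    (h : ∀ t, 0 ≤ t → |f t| ≤ C * exp (δ * t)) :
    Tendsto (fun t => exp (-a * t) * f t) atTop (𝓝 0) := by
  have h1 : Tendsto (fun t => C * exp ((δ - a) * t)) atTop (𝓝 0) := by
    rw [← mul_zero C]
    exact (tendsto_exp_atBot.comp
      (tendsto_id.const_mul_atTop_of_neg (sub_neg.2 hδ))).const_mul C
  refine squeeze_zero_norm' ?_ h1
  filter_upwards [eventually_ge_atTop 0] with t ht
  rw [norm_mul, norm_eq_abs, norm_eq_abs, abs_exp]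
  calc exp (-a * t) * |f t| ≤ exp (-a * t) * (C * exp (δ * t)) := by
        gcongr
        exact h t ht
    _ = C * exp ((δ - a) * t) := by
        rw [mul_left_comm, ← exp_add]
        ring_nf

end Deterministic

/-! ### Pathwise asymptotics of the estimators. -/

section Deterministic

open Real

/-- A continuous solution `x` of the Vasicek equation driven by a continuous path `b` of
sublinear growth. -/
structure IsVasicekPath (θ μ : ℝ) (b x : ℝ → ℝ) : Prop where
  θ_pos : 0 < θ
  continuous_noise : Continuous b
  sublinear : Tendsto (fun t => b t / t) atTop (𝓝 0)
  continuous_path : Continuous x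
  solves : SolvesVasicek θ μ b x

/-- `ζ_∞` of a path. -/
noncomputable def zetaPath (θ : ℝ) (b : ℝ → ℝ) : ℝ := θ * ∫ s in Ioi (0 : ℝ), exp (-θ * s) * b s

/-- `Z_T = e ^ (-θ T) ∫_0^T e ^ (θ s) db_s`, integrated by parts. -/
noncomputable def ouPath (θ : ℝ) (b : ℝ → ℝ) (T : ℝ) : ℝ :=
  b T - θ * (exp (-θ * T) * ∫ s in (0 : ℝ)..T, exp (θ * s) * b s)

/-- `T ∫_0^T x ^ 2 - (∫_0^T x) ^ 2`. -/
noncomputable def pathDisc (x : ℝ → ℝ) (T : ℝ) : ℝ :=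
  T * (∫ s in (0 : ℝ)..T, x s ^ 2) - (∫ s in (0 : ℝ)..T, x s) ^ 2

noncomputable def thetaPath (x : ℝ → ℝ) (T : ℝ) : ℝ :=
  ((1 / 2) * T * x T ^ 2 - x T * ∫ s in (0 : ℝ)..T, x s) / pathDisc x T

noncomputable def alphaPath (x : ℝ → ℝ) (T : ℝ) : ℝ :=
  (x T * (∫ s in (0 : ℝ)..T, x s ^ 2) - (1 / 2) * x T ^ 2 * ∫ s in (0 : ℝ)..T, x s) / pathDisc x T

noncomputable def muPath (x : ℝ → ℝ) (T : ℝ) : ℝ :=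
  ((∫ s in (0 : ℝ)..T, x s ^ 2) - (1 / 2) * x T * ∫ s in (0 : ℝ)..T, x s) /
    ((1 / 2) * T * x T - ∫ s in (0 : ℝ)..T, x s)

/-- The leading random factor in the expansion of the estimator of `θ`. -/
noncomputable def thetaFactor (θ μ : ℝ) (b x : ℝ → ℝ) (T : ℝ) : ℝ :=
  (μ + zetaPath θ b) ^ 2 * (T * exp (2 * θ * T) / pathDisc x T)

/-- The common denominator in the expansion of the estimator of `μ`. -/
noncomputable def muDenom (θ : ℝ) (x : ℝ → ℝ) (T : ℝ) : ℝ :=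
  θ * (1 / 2 - (∫ s in (0 : ℝ)..T, x s) / (T * x T))

/-- The factor of `b_T` in the expansion of the estimator of `μ`. -/
noncomputable def muFactor (θ : ℝ) (x : ℝ → ℝ) (T : ℝ) : ℝ := 1 / 2 / muDenom θ x T

/-- The factor of `Z_T / (μ + ζ_∞)` in the expansion of the estimator of `μ`. -/
noncomputable def muOuFactor (θ μ : ℝ) (b x : ℝ → ℝ) (T : ℝ) : ℝ :=
  -(μ + zetaPath θ b) ^ 2 * (exp (θ * T) / x T) / muDenom θ x T

namespace IsVasicekPath

variable {θ μ : ℝ} {b x : ℝ → ℝ} (h : IsVasicekPath θ μ b x)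
include h

lemma exists_remainder_bound {δ : ℝ} (hδ : 0 < δ) (hδθ : δ < θ) : ∃ C, 0 ≤ C ∧ ∀ t, 0 ≤ t →
    |x t - (μ + zetaPath θ b) * exp (θ * t)| ≤ C * exp (δ * t) := by
  obtain ⟨C, hC0, hC⟩ := exists_exp_bound_vasicekPath_sub (μ := μ) h.θ_pos h.continuous_noise
    h.sublinear hδ hδθ
  refine ⟨C, hC0, fun t ht => ?_⟩
  rw [h.solves.eq_vasicekPath h.continuous_noise h.continuous_path ht]
  exact hC t ht

lemma tendsto_path : Tendsto (fun T => exp (-θ * T) * x T) atTop (𝓝 (μ + zetaPath θ b)) := by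
  have hθ := h.θ_pos
  obtain ⟨C, -, hC⟩ := h.exists_remainder_bound (half_pos hθ) (half_lt_self hθ)
  have := (tendsto_zero_of_exp_bound (half_lt_self hθ) hC).add_const (μ + zetaPath θ b)
  rw [zero_add] at this
  refine this.congr fun T => ?_
  have hE : exp (-θ * T) * exp (θ * T) = 1 := by rw [← exp_add]; simp
  linear_combination -(μ + zetaPath θ b) * hE

lemma tendsto_integral :
    Tendsto (fun T => exp (-θ * T) * ∫ s in (0 : ℝ)..T, x s) atTop
      (𝓝 ((μ + zetaPath θ b) / θ)) :=
  tendsto_exp_neg_mul_integral h.continuous_path h.θ_pos h.tendsto_path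

lemma tendsto_sq_integral :
    Tendsto (fun T => exp (-(2 * θ) * T) * ∫ s in (0 : ℝ)..T, x s ^ 2) atTop
      (𝓝 ((μ + zetaPath θ b) ^ 2 / (2 * θ))) := by
  have hθ := h.θ_pos
  have hxc := h.continuous_path
  refine tendsto_exp_neg_mul_integral (f := fun s => x s ^ 2) (by fun_prop) (by linarith) ?_
  refine (h.tendsto_path.pow 2).congr fun T => ?_
  rw [mul_pow, ← exp_nat_mul]
  ring_nf

/-- Both `∫ x ^ 2` and `(∫ x) ^ 2` have order `e ^ (2 θ T)`; only the first carries the factor `T`,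
so it alone decides the limit. -/
lemma tendsto_pathDisc :
    Tendsto (fun T => pathDisc x T / (T * exp (2 * θ * T))) atTop
      (𝓝 ((μ + zetaPath θ b) ^ 2 / (2 * θ))) := by
  have h1 := h.tendsto_sq_integral.sub ((h.tendsto_integral.pow 2).mul tendsto_inv_atTop_zero)
  rw [mul_zero, sub_zero] at h1
  refine h1.congr' ?_
  filter_upwards [eventually_gt_atTop 0] with T hT
  have e1 : exp (-(2 * θ) * T) = (exp (2 * θ * T))⁻¹ := by rw [← exp_neg]; ring_nf
  have e2 : exp (-θ * T) ^ 2 = (exp (2 * θ * T))⁻¹ := by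
    rw [← exp_neg, ← exp_nat_mul]; push_cast; ring_nf
  have hE := exp_ne_zero (2 * θ * T)
  rw [mul_pow, e1, e2, pathDisc]
  field_simp

/-- For `T ≥ 1`, `1 + |s| ≤ 2 T` on `[0, T]`, so `|b s|` is at most `2 T` times `|b s| / (1 + |s|)`.
This quotient tends to zero, hence so does its exponentially weighted average. -/
lemma tendsto_ou_div : Tendsto (fun T => ouPath θ b T / T) atTop (𝓝 0) := by
  have hθ := h.θ_pos
  have hbc := h.continuous_noise
  have hcont : Continuous fun s => exp (θ * s) * (|b s| / (1 + |s|)) := by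
    have : ∀ s : ℝ, 1 + |s| ≠ 0 := fun s => by positivity
    fun_prop (disch := assumption)
  have h1 : Tendsto (fun s => exp (-θ * s) * (exp (θ * s) * (|b s| / (1 + |s|)))) atTop (𝓝 0) := by
    have := h.sublinear.abs
    rw [abs_zero] at this
    refine squeeze_zero' (Eventually.of_forall fun s => by positivity) ?_ this
    filter_upwards [eventually_gt_atTop 0] with s hs
    rw [← mul_assoc, ← exp_add, neg_mul, neg_add_cancel, exp_zero, one_mul, abs_div]
    gcongr
    linarith
  have h2 := (tendsto_exp_neg_mul_integral hcont hθ h1).const_mul (2 * θ)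
  rw [zero_div, mul_zero] at h2
  have h3 : Tendsto (fun T => θ * (exp (-θ * T) * ∫ s in (0 : ℝ)..T, exp (θ * s) * b s) / T)
      atTop (𝓝 0) := by
    refine squeeze_zero_norm' ?_ h2
    filter_upwards [eventually_ge_atTop 1] with T hT
    have hT0 : 0 < T := by linarith
    have hle : |∫ s in (0 : ℝ)..T, exp (θ * s) * b s| ≤
        (2 * T) * ∫ s in (0 : ℝ)..T, exp (θ * s) * (|b s| / (1 + |s|)) := by
      rw [← intervalIntegral.integral_const_mul]
      refine (intervalIntegral.abs_integral_le_integral_abs hT0.le).trans ?_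
      refine intervalIntegral.integral_mono_on hT0.le
        (Continuous.intervalIntegrable (by fun_prop) _ _)
        (Continuous.intervalIntegrable (by fun_prop) _ _) fun s hs => ?_
      rw [abs_mul, abs_exp, mul_left_comm]
      have hs1 : 1 + |s| ≤ 2 * T := by rw [abs_of_nonneg hs.1]; linarith [hs.2]
      have : 0 < 1 + |s| := by positivity
      gcongr
      rw [← mul_div_assoc, le_div_iff₀ this]
      nlinarith [abs_nonneg (b s)]
    rw [norm_eq_abs, abs_div, abs_mul, abs_mul, abs_exp, abs_of_pos hθ, abs_of_pos hT0,
      div_le_iff₀ hT0]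
    calc θ * (exp (-θ * T) * |∫ s in (0 : ℝ)..T, exp (θ * s) * b s|)
        ≤ θ * (exp (-θ * T) * ((2 * T) *
          ∫ s in (0 : ℝ)..T, exp (θ * s) * (|b s| / (1 + |s|)))) := by gcongr
      _ = _ := by ring
  have h4 := h.sublinear.sub h3
  rw [sub_zero] at h4
  refine h4.congr fun T => ?_
  rw [ouPath, sub_div]

/-- The bracket `x_T b_T - θ ∫ b x - b_T ^ 2 / 2 - θ μ ∫ b` is asymptotic to
`e ^ (θ T) (μ + ζ_∞) Z_T`. -/
lemma tendsto_bracket : Tendsto (fun T => exp (-θ * T) * (x T * b T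
      - θ * (∫ s in (0 : ℝ)..T, b s * x s) - (1 / 2) * b T ^ 2 - θ * μ * ∫ s in (0 : ℝ)..T, b s)
      - (μ + zetaPath θ b) * ouPath θ b T) atTop (𝓝 0) := by
  have hθ := h.θ_pos
  have hbc := h.continuous_noise
  have hxc := h.continuous_path
  set M := μ + zetaPath θ b
  -- Rate `θ / 4` for both `b` and the remainder `r` keeps the products `b r` and `b ^ 2` at rate `θ
  -- / 2`, below the normalisation `e ^ (θ t)`.
  obtain ⟨C, hC0, hC⟩ := exists_exp_bound_of_sublinear hbc h.sublinear (δ := θ / 4) (by linarith)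
  obtain ⟨R, hR0, hR⟩ := h.exists_remainder_bound (δ := θ / 4) (by linarith) (by linarith)
  set r : ℝ → ℝ := fun t => x t - M * exp (θ * t) with hr
  have hrc : Continuous r := by fun_prop
  have hlim : ∀ f : ℝ → ℝ, ∀ D, (∀ t, 0 ≤ t → |f t| ≤ D * exp (θ / 2 * t)) →
      Tendsto (fun t => exp (-θ * t) * f t) atTop (𝓝 0) := fun f D hf =>
    tendsto_zero_of_exp_bound (half_lt_self hθ) hf
  have hmul : ∀ t, exp (θ / 4 * t) * exp (θ / 4 * t) = exp (θ / 2 * t) := fun t => by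
    rw [← exp_add]; ring_nf
  have hrb : Tendsto (fun t => exp (-θ * t) * (b t * r t)) atTop (𝓝 0) :=
    hlim _ (C * R) fun t ht => by
      rw [abs_mul, ← hmul]
      calc |b t| * |r t| ≤ (C * exp (θ / 4 * t)) * (R * exp (θ / 4 * t)) := by
            gcongr
            · exact hC t ht
            · exact hR t ht
        _ = _ := by ring
  have hbb : Tendsto (fun t => exp (-θ * t) * b t ^ 2) atTop (𝓝 0) :=
    hlim _ (C * C) fun t ht => by
      rw [pow_two, abs_mul, ← hmul]
      calc |b t| * |b t| ≤ (C * exp (θ / 4 * t)) * (C * exp (θ / 4 * t)) := by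
            gcongr
            · exact hC t ht
            · exact hC t ht
        _ = _ := by ring
  have hb1 := tendsto_exp_neg_mul_of_sublinear h.sublinear hθ
  have i1 := tendsto_exp_neg_mul_integral (hbc.mul hrc) hθ hrb
  have i2 := tendsto_exp_neg_mul_integral hbc hθ hb1
  have := ((hrb.sub (i1.const_mul θ)).sub (hbb.const_mul (1 / 2))).sub (i2.const_mul (θ * μ))
  simp only [zero_div, mul_zero, sub_zero] at this
  refine this.congr fun T => ?_
  -- The part `M e ^ (θ s)` of `x` reproduces `M Z_T` exactly; all else is negligible by the bounds
  -- above.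
  have hI : ∫ s in (0 : ℝ)..T, b s * x s =
      (∫ s in (0 : ℝ)..T, b s * r s) + M * ∫ s in (0 : ℝ)..T, exp (θ * s) * b s := by
    rw [← intervalIntegral.integral_const_mul, ← intervalIntegral.integral_add]
    · exact intervalIntegral.integral_congr fun s _ => by simp only [hr]; ring
    all_goals exact Continuous.intervalIntegrable (by fun_prop) _ _
  have hE : exp (-θ * T) * exp (θ * T) = 1 := by rw [← exp_add]; simp
  rw [hI, ouPath]
  simp only [hr]
  linear_combination -(M * b T) * hE

lemma tendsto_exp_div (hM : μ + zetaPath θ b ≠ 0) :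
    Tendsto (fun T => exp (θ * T) / x T) atTop (𝓝 (μ + zetaPath θ b)⁻¹) := by
  refine (h.tendsto_path.inv₀ hM).congr fun T => ?_
  rw [neg_mul, exp_neg, mul_inv, inv_inv, div_eq_mul_inv]

lemma eventually_ne_zero (hM : μ + zetaPath θ b ≠ 0) : ∀ᶠ T in atTop, x T ≠ 0 :=
  (h.tendsto_path.eventually_ne hM).mono fun _ hT => right_ne_zero_of_mul hT

lemma eventually_pathDisc_ne_zero (hM : μ + zetaPath θ b ≠ 0) :
    ∀ᶠ T in atTop, pathDisc x T ≠ 0 := by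
  have hθ := h.θ_pos
  exact (h.tendsto_pathDisc.eventually_ne (by positivity)).mono fun T hT h0 => hT (by simp [h0])

lemma tendsto_inv_pathDisc (hM : μ + zetaPath θ b ≠ 0) :
    Tendsto (fun T => T * exp (2 * θ * T) / pathDisc x T) atTop
      (𝓝 ((μ + zetaPath θ b) ^ 2 / (2 * θ))⁻¹) := by
  have hθ := h.θ_pos
  exact (h.tendsto_pathDisc.inv₀ (by positivity)).congr fun _ => inv_div _ _

lemma tendsto_thetaFactor (hM : μ + zetaPath θ b ≠ 0) :
    Tendsto (thetaFactor θ μ b x) atTop (𝓝 (2 * θ)) := by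
  have hθ := h.θ_pos
  have := (h.tendsto_inv_pathDisc hM).const_mul ((μ + zetaPath θ b) ^ 2)
  rwa [inv_div, mul_div_cancel₀ _ (by positivity)] at this

lemma tendsto_thetaPath_expansion (hM : μ + zetaPath θ b ≠ 0) :
    Tendsto (fun T => exp (θ * T) * (thetaPath x T - θ)
      - thetaFactor θ μ b x T * (ouPath θ b T / (μ + zetaPath θ b))) atTop (𝓝 0) := by
  have h1 := (h.tendsto_bracket.sub (h.sublinear.mul h.tendsto_integral)).mul
    (h.tendsto_inv_pathDisc hM)
  rw [zero_mul, sub_zero, zero_mul] at h1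
  refine h1.congr' ?_
  filter_upwards [eventually_gt_atTop 0, h.eventually_pathDisc_ne_zero hM] with T hT hD
  have e1 := h.solves.integral_eq h.continuous_path hT.le
  have e2 := h.solves.integral_sq_eq h.continuous_noise h.continuous_path hT.le
  set I1 := ∫ s in (0 : ℝ)..T, x s
  set I2 := ∫ s in (0 : ℝ)..T, x s ^ 2
  set J := ∫ s in (0 : ℝ)..T, b s
  set L := ∫ s in (0 : ℝ)..T, b s * x s
  have hdisc : pathDisc x T = T * I2 - I1 ^ 2 := rfl
  -- Eliminating `∫ x ^ 2` by the energy identity and `x T * ∫ x` by the integrated equation cancels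
  -- the drift terms in `θ μ T ∫ x`; what remains is `T` times the bracket, minus `b T * ∫ x`.
  have hnum : (1 / 2) * T * x T ^ 2 - x T * I1 - θ * pathDisc x T =
      T * (x T * b T - θ * L - (1 / 2) * b T ^ 2 - θ * μ * J) - b T * I1 := by
    rw [hdisc]
    linear_combination (-T) * e2 - I1 * e1
  have hth : thetaPath x T - θ =
      (T * (x T * b T - θ * L - (1 / 2) * b T ^ 2 - θ * μ * J) - b T * I1) / pathDisc x T := by
    rw [thetaPath, ← hnum, sub_div _ (θ * _), mul_div_cancel_right₀ _ hD]
  have hE : exp (2 * θ * T) = exp (θ * T) * exp (θ * T) := by rw [← exp_add]; ring_nf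
  have hE' : exp (-θ * T) = (exp (θ * T))⁻¹ := by rw [← exp_neg]; ring_nf
  have hE0 := exp_ne_zero (θ * T)
  rw [hth, thetaFactor, hE, hE']
  field_simp
  ring

lemma tendsto_muDenom (hM : μ + zetaPath θ b ≠ 0) :
    Tendsto (muDenom θ x) atTop (𝓝 (θ / 2)) := by
  have h1 := (h.tendsto_integral.mul (h.tendsto_exp_div hM)).mul tendsto_inv_atTop_zero
  rw [mul_zero] at h1
  have h2 := (h1.const_sub (1 / 2)).const_mul θ
  rw [sub_zero, mul_one_div] at h2
  refine h2.congr fun T => ?_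
  have hE : exp (-θ * T) * exp (θ * T) = 1 := by rw [← exp_add]; simp
  rw [muDenom, div_eq_mul_inv _ (x T), div_eq_mul_inv _ (T * x T), mul_inv]
  linear_combination (-θ * (∫ s in (0 : ℝ)..T, x s) * (x T)⁻¹ * T⁻¹) * hE

lemma tendsto_muFactor (hM : μ + zetaPath θ b ≠ 0) :
    Tendsto (muFactor θ x) atTop (𝓝 (1 / θ)) := by
  have hθ := h.θ_pos
  have := (tendsto_const_nhds (x := (1 / 2 : ℝ))).div (h.tendsto_muDenom hM) (by positivity)
  rw [show (1 / 2 : ℝ) / (θ / 2) = 1 / θ by field_simp] at this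
  exact this

lemma tendsto_muOuFactor (hM : μ + zetaPath θ b ≠ 0) :
    Tendsto (muOuFactor θ μ b x) atTop
      (𝓝 (-(μ + zetaPath θ b) ^ 2 * (μ + zetaPath θ b)⁻¹ / (θ / 2))) := by
  have hθ := h.θ_pos
  exact ((h.tendsto_exp_div hM).const_mul _).div (h.tendsto_muDenom hM) (by positivity)

/-- Up to the factor `θ`, the numerator of the error is exactly `x T * b T / 2` minus the bracket,
and the denominator is `T * x T * muDenom`. The first piece gives the `b T` term, the bracket the
`Z_T` term. -/
lemma tendsto_muPath_expansion (hM : μ + zetaPath θ b ≠ 0) :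
    Tendsto (fun T => T * (muPath x T - μ) - (muFactor θ x T * b T
      + muOuFactor θ μ b x T * (ouPath θ b T / (μ + zetaPath θ b)))) atTop (𝓝 0) := by
  have hθ := h.θ_pos
  have h1 := ((h.tendsto_bracket.mul (h.tendsto_exp_div hM)).div (h.tendsto_muDenom hM)
    (by positivity)).neg
  rw [zero_mul, zero_div, neg_zero] at h1
  refine h1.congr' ?_
  filter_upwards [eventually_gt_atTop 0, h.eventually_ne_zero hM,
    (h.tendsto_muDenom hM).eventually_ne (by positivity : θ / 2 ≠ 0)] with T hT hx0 hD
  have e1 := h.solves.integral_eq h.continuous_path hT.le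
  have e2 := h.solves.integral_sq_eq h.continuous_noise h.continuous_path hT.le
  set I1 := ∫ s in (0 : ℝ)..T, x s
  set I2 := ∫ s in (0 : ℝ)..T, x s ^ 2
  set J := ∫ s in (0 : ℝ)..T, b s
  set L := ∫ s in (0 : ℝ)..T, b s * x s
  have hden : θ * ((1 / 2) * T * x T - I1) = T * x T * muDenom θ x T := by
    simp only [muDenom]
    field_simp
    rfl
  have hden0 : (1 / 2) * T * x T - I1 ≠ 0 := fun h0 => by
    rw [h0, mul_zero] at hden
    exact (mul_ne_zero (mul_ne_zero hT.ne' hx0) hD) hden.symm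
  have hnum : θ * (I2 - (1 / 2) * x T * I1 - μ * ((1 / 2) * T * x T - I1)) =
      (1 / 2) * x T * b T - (x T * b T - θ * L - (1 / 2) * b T ^ 2 - θ * μ * J) := by
    linear_combination e2 + (1 / 2) * x T * e1
  have hmu : muPath x T - μ = ((1 / 2) * x T * b T -
      (x T * b T - θ * L - (1 / 2) * b T ^ 2 - θ * μ * J)) / (T * x T * muDenom θ x T) := by
    rw [← hnum, ← hden, mul_div_mul_left _ _ hθ.ne', sub_div _ (μ * _), mul_div_cancel_right₀ _ hden0]
    rfl
  have hE' : exp (-θ * T) = (exp (θ * T))⁻¹ := by rw [← exp_neg]; ring_nf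
  have hE0 := exp_ne_zero (θ * T)
  simp only [Pi.div_apply]
  rw [hmu, muFactor, muOuFactor, hE']
  field_simp
  ring

/-- The exponential rate absorbs any power of `T`: in the expansion `Z_T / T → 0` is paired with `T
^ 2 e ^ (-θ T)`. This makes the error in `θ` invisible at the scale used for `α`. -/
lemma tendsto_mul_thetaPath_sub (hM : μ + zetaPath θ b ≠ 0) :
    Tendsto (fun T => T * (thetaPath x T - θ)) atTop (𝓝 0) := by
  have hθ := h.θ_pos
  have h1 : Tendsto (fun T : ℝ => T ^ (2 : ℝ) * exp (-θ * T)) atTop (𝓝 0) :=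
    tendsto_rpow_mul_exp_neg_mul_atTop_nhds_zero 2 θ hθ
  have h1' : Tendsto (fun T : ℝ => T ^ (1 : ℝ) * exp (-θ * T)) atTop (𝓝 0) :=
    tendsto_rpow_mul_exp_neg_mul_atTop_nhds_zero 1 θ hθ
  have h2 := (h1'.mul (h.tendsto_thetaPath_expansion hM)).add
    (((h1.mul h.tendsto_ou_div).mul (h.tendsto_thetaFactor hM)).mul_const (μ + zetaPath θ b)⁻¹)
  simp only [zero_mul, add_zero, mul_zero] at h2
  refine h2.congr' ?_
  filter_upwards [eventually_gt_atTop 0] with T hT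
  have hE' : exp (-θ * T) = (exp (θ * T))⁻¹ := by rw [← exp_neg]; ring_nf
  have hE0 := exp_ne_zero (θ * T)
  rw [rpow_one, rpow_two, hE']
  field_simp
  ring

theorem tendsto_thetaPath (hM : μ + zetaPath θ b ≠ 0) :
    Tendsto (thetaPath x) atTop (𝓝 θ) := by
  have h1 := ((h.tendsto_mul_thetaPath_sub hM).mul tendsto_inv_atTop_zero).add_const θ
  rw [zero_mul, zero_add] at h1
  refine h1.congr' ?_
  filter_upwards [eventually_gt_atTop 0] with T hT
  field_simp
  ring

theorem tendsto_muPath (hM : μ + zetaPath θ b ≠ 0) :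
    Tendsto (muPath x) atTop (𝓝 μ) := by
  have h1 := (((h.tendsto_muPath_expansion hM).mul tendsto_inv_atTop_zero).add
    (((h.tendsto_muFactor hM).mul h.sublinear).add
    (((h.tendsto_muOuFactor hM).mul h.tendsto_ou_div).mul_const
      (μ + zetaPath θ b)⁻¹))).add_const μ
  simp only [zero_mul, zero_add, mul_zero] at h1
  refine h1.congr' ?_
  filter_upwards [eventually_gt_atTop 0] with T hT
  field_simp
  ring

lemma eventually_alphaPath_eq (hM : μ + zetaPath θ b ≠ 0) :
    ∀ᶠ T in atTop, alphaPath x T = muPath x T * thetaPath x T := by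
  have hθ := h.θ_pos
  filter_upwards [eventually_gt_atTop 0, h.eventually_ne_zero hM,
    h.eventually_pathDisc_ne_zero hM,
    (h.tendsto_thetaPath hM).eventually_ne h.θ_pos.ne'] with T hT hx0 hD hth
  -- This denominator is a factor of the numerator of `thetaPath`, which is eventually nonzero
  -- because it tends to `θ > 0`.
  have hden : (1 / 2) * T * x T - (∫ s in (0 : ℝ)..T, x s) ≠ 0 := fun h0 => by
    refine hth ?_
    rw [thetaPath, show (1 / 2) * T * x T ^ 2 - x T * (∫ s in (0 : ℝ)..T, x s) =
      x T * ((1 / 2) * T * x T - (∫ s in (0 : ℝ)..T, x s)) by ring, h0]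
    simp
  rw [alphaPath, muPath, thetaPath, div_mul_div_comm, div_eq_div_iff hD (mul_ne_zero hden hD)]
  ring

theorem tendsto_alphaPath (hM : μ + zetaPath θ b ≠ 0) :
    Tendsto (alphaPath x) atTop (𝓝 (μ * θ)) :=
  ((h.tendsto_muPath hM).mul (h.tendsto_thetaPath hM)).congr'
    ((h.eventually_alphaPath_eq hM).mono fun _ hT => hT.symm)

/-- Eventually the error is `θ (μ̂ - μ) + μ̂ (θ̂ - θ)`, and the last summand is `o(1 / T)`. -/
lemma tendsto_alphaPath_expansion (hM : μ + zetaPath θ b ≠ 0) :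
    Tendsto (fun T => T * (alphaPath x T - μ * θ) - (θ * muFactor θ x T * b T
      + θ * muOuFactor θ μ b x T * (ouPath θ b T / (μ + zetaPath θ b)))) atTop (𝓝 0) := by
  have h1 := ((h.tendsto_muPath_expansion hM).const_mul θ).add
    ((h.tendsto_muPath hM).mul (h.tendsto_mul_thetaPath_sub hM))
  rw [mul_zero, mul_zero, add_zero] at h1
  refine h1.congr' ?_
  filter_upwards [h.eventually_alphaPath_eq hM] with T hT
  rw [hT]
  ring

end IsVasicekPath

end Deterministic

/-! ### The exponential law as averaging measure. -/

section ExponentialLaw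

open Real

/-- The exponential law of rate `θ`. -/
noncomputable def expLaw (θ : ℝ) : Measure ℝ :=
  (volume.restrict (Ioi 0)).withDensity fun s => ENNReal.ofReal (θ * exp (-θ * s))

variable {θ : ℝ}

lemma integral_expLaw (hθ : 0 < θ) (f : ℝ → ℝ) :
    ∫ s, f s ∂expLaw θ = θ * ∫ s in Ioi (0 : ℝ), exp (-θ * s) * f s := by
  rw [expLaw, integral_withDensity_eq_integral_toReal_smul (by fun_prop)
    (Eventually.of_forall fun _ => ENNReal.ofReal_lt_top), ← integral_const_mul]
  refine integral_congr_ae (Eventually.of_forall fun s => ?_)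
  simp only [smul_eq_mul]
  rw [ENNReal.toReal_ofReal (by positivity), mul_assoc]

lemma integrable_expLaw_iff (hθ : 0 < θ) (f : ℝ → ℝ) :
    Integrable f (expLaw θ) ↔ IntegrableOn (fun s => exp (-θ * s) * f s) (Ioi 0) := by
  rw [expLaw, integrable_withDensity_iff_integrable_smul' (by fun_prop)
    (Eventually.of_forall fun _ => ENNReal.ofReal_lt_top), IntegrableOn,
    ← integrable_const_mul_iff (c := θ) (IsUnit.mk0 _ hθ.ne') (fun s => exp (-θ * s) * f s)]
  refine integrable_congr (Eventually.of_forall fun s => ?_)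
  simp only [smul_eq_mul]
  rw [ENNReal.toReal_ofReal (by positivity), mul_assoc]

lemma ae_expLaw_pos (θ : ℝ) : ∀ᵐ s ∂expLaw θ, 0 < s :=
  (withDensity_absolutelyContinuous _ _).ae_le (ae_restrict_mem measurableSet_Ioi)

lemma isProbabilityMeasure_expLaw (hθ : 0 < θ) : IsProbabilityMeasure (expLaw θ) := by
  refine ⟨?_⟩
  rw [expLaw, withDensity_apply _ MeasurableSet.univ, Measure.restrict_univ,
    ← ofReal_integral_eq_lintegral_ofReal ((integrableOn_exp_neg_mul_Ioi hθ 0).const_mul θ)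
      (Eventually.of_forall fun s => by positivity),
    integral_const_mul, integral_exp_neg_mul_Ioi hθ]
  simp [hθ.ne']

lemma integrable_rpow_expLaw (hθ : 0 < θ) {p : ℝ} (hp : -1 < p) :
    Integrable (fun s => s ^ p) (expLaw θ) := by
  rw [integrable_expLaw_iff hθ]
  have := integrableOn_rpow_mul_exp_neg_mul_rpow (s := p) (p := 1) hp one_pos hθ
  refine this.congr_fun (fun s _ => ?_) measurableSet_Ioi
  simp only [rpow_one]
  ring

lemma integral_rpow_expLaw (hθ : 0 < θ) {p : ℝ} (hp : -1 < p) :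
    ∫ s, s ^ p ∂expLaw θ = Gamma (p + 1) / θ ^ p := by
  rw [integral_expLaw hθ]
  have := integral_rpow_mul_exp_neg_mul_Ioi (a := p + 1) (r := θ) (by linarith) hθ
  rw [show p + 1 - 1 = p by ring] at this
  rw [show ∫ s in Ioi (0 : ℝ), exp (-θ * s) * s ^ p = ∫ t in Ioi (0 : ℝ), t ^ p * exp (-(θ * t)) from
    integral_congr_ae (Eventually.of_forall fun s => by simp only []; ring_nf), this,
    rpow_add_one (by positivity), one_div, inv_rpow hθ.le]
  field_simp

lemma zetaPath_eq_integral_expLaw (hθ : 0 < θ) (b : ℝ → ℝ) :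
    zetaPath θ b = ∫ s, b s ∂expLaw θ := (integral_expLaw hθ b).symm

lemma integrable_expLaw_of_sublinear (hθ : 0 < θ) {b : ℝ → ℝ} (hbc : Continuous b)
    (hb : Tendsto (fun t => b t / t) atTop (𝓝 0)) : Integrable b (expLaw θ) :=
  (integrable_expLaw_iff hθ b).2 (integrableOn_exp_neg_mul_of_sublinear hbc hb hθ)

lemma integrable_expLaw_max (hθ : 0 < θ) {b : ℝ → ℝ} (hbc : Continuous b) {T : ℝ} (hT : 0 ≤ T) :
    Integrable (fun s => b (max (T - s) 0)) (expLaw θ) := by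
  have := isProbabilityMeasure_expLaw hθ
  obtain ⟨C, hC⟩ := (isCompact_Icc (a := (0 : ℝ)) (b := T)).exists_bound_of_continuousOn
    hbc.continuousOn
  refine Integrable.of_bound (by fun_prop) C ?_
  filter_upwards [ae_expLaw_pos θ] with s hs
  exact hC _ ⟨le_max_right _ _, max_le (by linarith) hT⟩

/-- Time reversal `s ↦ T - s` in `Z_T`. The total mass one produces `b T`, and since `b 0 = 0`
clamping at zero costs nothing. The averaging measure becomes independent of `T`, the same as for
`ζ_∞`. -/
lemma ouPath_eq_integral_expLaw (hθ : 0 < θ) {b : ℝ → ℝ} (hbc : Continuous b) (hb0 : b 0 = 0)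
    {T : ℝ} (hT : 0 ≤ T) :
    ouPath θ b T = ∫ s, (b T - b (max (T - s) 0)) ∂expLaw θ := by
  have := isProbabilityMeasure_expLaw hθ
  rw [integral_sub (integrable_const _) (integrable_expLaw_max hθ hbc hT), integral_const,
    probReal_univ, one_smul, ouPath, integral_expLaw hθ]
  have hsub := intervalIntegral.integral_comp_sub_left
    (a := 0) (b := T) (fun s => exp (-θ * T) * (exp (θ * s) * b s)) T
  simp only [sub_self, sub_zero] at hsub
  have h0 : ∀ s ∈ Ioi (0 : ℝ) \ Ioc 0 T, exp (-θ * s) * b (max (T - s) 0) = 0 := fun s hs => by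
    have : T < s := by
      by_contra hc
      exact hs.2 ⟨hs.1, not_lt.1 hc⟩
    rw [max_eq_right (by linarith), hb0, mul_zero]
  rw [setIntegral_eq_of_subset_of_forall_sdiff_eq_zero measurableSet_Ioi Ioc_subset_Ioi_self h0,
    ← intervalIntegral.integral_of_le hT, ← intervalIntegral.integral_const_mul, ← hsub]
  congr 2
  refine intervalIntegral.integral_congr fun s hs => ?_
  rw [uIcc_of_le hT] at hs
  rw [max_eq_left (by linarith [hs.2]), ← mul_assoc, ← exp_add]
  ring_nf

/-- The distance of two independent exponential variables is exponential: moments. -/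
lemma integral_abs_sub_rpow_expLaw (hθ : 0 < θ) {p : ℝ} (hp : 0 < p) :
    ∫ z, |z.1 - z.2| ^ p ∂(expLaw θ).prod (expLaw θ) = Gamma (p + 1) / θ ^ p := by
  have := isProbabilityMeasure_expLaw hθ
  -- Splitting by the sign of `z.1 - z.2` gives two halves exchanged by the swap, hence of equal
  -- integral.
  set g : ℝ × ℝ → ℝ := fun z => (max (z.2 - z.1) 0) ^ p with hg
  have hgc : Continuous g := by
    have : Continuous fun x : ℝ => x ^ p := continuous_rpow_const hp.le
    fun_prop
  have hsum : ∀ z : ℝ × ℝ, |z.1 - z.2| ^ p = g z + g z.swap := fun z => by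
    simp only [hg, Prod.fst_swap, Prod.snd_swap]
    rcases le_total z.1 z.2 with hz | hz
    · rw [max_eq_left (by linarith : 0 ≤ z.2 - z.1), max_eq_right (by linarith : z.1 - z.2 ≤ 0),
        zero_rpow hp.ne', abs_of_nonpos (by linarith)]
      ring_nf
    · rw [max_eq_right (by linarith : z.2 - z.1 ≤ 0), max_eq_left (by linarith : 0 ≤ z.1 - z.2),
        zero_rpow hp.ne', abs_of_nonneg (by linarith)]
      ring
  have hgint : Integrable g ((expLaw θ).prod (expLaw θ)) := by
    refine Integrable.mono' ((integrable_rpow_expLaw hθ (by linarith : -1 < p)).comp_snd (expLaw θ))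
      (by fun_prop) ?_
    filter_upwards [Measure.quasiMeasurePreserving_fst.ae (ae_expLaw_pos θ),
      Measure.quasiMeasurePreserving_snd.ae (ae_expLaw_pos θ)] with z hz1 hz2
    have : 0 ≤ max (z.2 - z.1) 0 := le_max_right _ _
    rw [norm_eq_abs, abs_of_nonneg (rpow_nonneg this _)]
    exact rpow_le_rpow this (max_le (by linarith) hz2.le) hp.le
  -- Memorylessness: beyond `s` the variable `t - s` is again exponential, weighted by `e ^ (-θ s)`.
  have hinner : ∀ s, 0 < s → ∫ t, g (s, t) ∂expLaw θ = exp (-θ * s) * (Gamma (p + 1) / θ ^ p) :=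
    fun s hs => by
    have h0 : ∀ t ∈ Ioi (0 : ℝ) \ Ioi s, exp (-θ * t) * g (s, t) = 0 := fun t ht => by
      have : t ≤ s := not_lt.1 ht.2
      simp only [hg]
      rw [max_eq_right (by linarith), zero_rpow hp.ne', mul_zero]
    rw [← integral_rpow_expLaw hθ (by linarith : -1 < p), integral_expLaw hθ, integral_expLaw hθ,
      setIntegral_eq_of_subset_of_forall_sdiff_eq_zero measurableSet_Ioi (Ioi_subset_Ioi hs.le) h0,
      mul_left_comm (exp _)]
    congr 1
    rw [← integral_const_mul, ← integral_indicator measurableSet_Ioi,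
      ← integral_add_right_eq_self _ s, ← integral_indicator measurableSet_Ioi]
    refine integral_congr_ae (Eventually.of_forall fun t => ?_)
    beta_reduce
    by_cases ht : 0 < t
    · rw [indicator_of_mem (s := Ioi s) (by simpa using ht),
        indicator_of_mem (s := Ioi 0) (by simpa using ht)]
      simp only [hg, add_sub_cancel_right]
      rw [max_eq_left ht.le, ← mul_assoc, ← exp_add]
      ring_nf
    · rw [indicator_of_notMem (s := Ioi s) (by simpa using ht),
        indicator_of_notMem (s := Ioi 0) (by simpa using ht)]
  have hhalf : ∫ z, g z ∂(expLaw θ).prod (expLaw θ) = (Gamma (p + 1) / θ ^ p) / 2 := by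
    rw [integral_prod _ hgint, integral_congr_ae ((ae_expLaw_pos θ).mono hinner),
      integral_mul_const, integral_expLaw hθ]
    simp only [← exp_add]
    rw [show (fun s : ℝ => exp (-θ * s + -θ * s)) = fun s => exp (-(2 * θ) * s) by
      ext s; ring_nf, integral_exp_neg_mul_Ioi (by linarith)]
    simp
    field_simp
  simp_rw [hsum]
  have hgswap : Integrable (fun z => g z.swap) ((expLaw θ).prod (expLaw θ)) := hgint.swap
  rw [integral_add hgint hgswap, integral_prod_swap, hhalf]
  ring

end ExponentialLaw

/-! ### Sublinear growth of fractional Brownian motion. -/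

section Growth

/-- Dyadic chaining on `[0, 1)`. -/
lemma abs_sub_le_of_dyadic {f : ℝ → ℝ} (hf : Continuous f) {A r : ℝ} (hA : 0 ≤ A) (hr0 : 0 ≤ r)
    (hr1 : r < 1)
    (h : ∀ m k : ℕ, k < 2 ^ m → |f ((k + 1) / 2 ^ m) - f (k / 2 ^ m)| ≤ A * r ^ m)
    {t : ℝ} (ht0 : 0 ≤ t) (ht1 : t < 1) : |f t - f 0| ≤ A * (1 - r)⁻¹ := by
  set d : ℕ → ℕ := fun m => ⌊t * 2 ^ m⌋₊ with hd
  have hpow : ∀ m : ℕ, (0 : ℝ) < 2 ^ m := fun m => by positivity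
  -- Successive dyadic floors of `t` either agree or differ by one step of level `m + 1`.
  have hstep : ∀ m, |f (d (m + 1) / 2 ^ (m + 1)) - f (d m / 2 ^ m)| ≤ A * r ^ (m + 1) := fun m => by
    have h1 : (d m : ℝ) ≤ t * 2 ^ m := Nat.floor_le (by positivity)
    have h2 : t * 2 ^ m < d m + 1 := Nat.lt_floor_add_one _
    have hlo : 2 * d m ≤ d (m + 1) := Nat.le_floor (by push_cast; rw [pow_succ]; linarith)
    have hhi : d (m + 1) < 2 * d m + 2 := (Nat.floor_lt (by positivity)).2 (by
      push_cast; rw [pow_succ]; linarith)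
    have heq : (d m : ℝ) / 2 ^ m = (2 * d m : ℕ) / 2 ^ (m + 1) := by
      push_cast; rw [pow_succ]; field_simp
    obtain h' | h' : d (m + 1) = 2 * d m ∨ d (m + 1) = 2 * d m + 1 := by omega
    · rw [heq, h', sub_self, abs_zero]
      positivity
    · rw [heq, h']
      have hlt : 2 * d m < 2 ^ (m + 1) := by
        have : (d m : ℝ) < 2 ^ m := h1.trans_lt (by nlinarith [hpow m])
        have : d m < 2 ^ m := by exact_mod_cast this
        rw [pow_succ]; omega
      have := h (m + 1) (2 * d m) hlt
      push_cast at this ⊢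
      exact this
  have hsum : ∀ m, |f (d m / 2 ^ m) - f 0| ≤ A * ∑ j ∈ Finset.range (m + 1), r ^ j := fun m => by
    induction m with
    | zero =>
      have : d 0 = 0 := by
        simp only [hd, pow_zero, mul_one]
        exact Nat.floor_eq_zero.2 ht1
      simp [this, hA]
    | succ m ih =>
      rw [Finset.sum_range_succ, mul_add]
      have h3 := abs_sub_le (f (d (m + 1) / 2 ^ (m + 1))) (f (d m / 2 ^ m)) (f 0)
      have h4 := hstep m
      linarith
  have hlim : Tendsto (fun m => f (d m / 2 ^ m)) atTop (𝓝 (f t)) := by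
    refine (hf.tendsto t).comp ?_
    have h1 : Tendsto (fun m : ℕ => t - (1 / 2 : ℝ) ^ m) atTop (𝓝 t) := by
      simpa using (tendsto_pow_atTop_nhds_zero_of_lt_one (r := (1 / 2 : ℝ)) (by norm_num)
        (by norm_num)).const_sub t
    refine tendsto_of_tendsto_of_tendsto_of_le_of_le h1 tendsto_const_nhds (fun m => ?_)
      (fun m => ?_)
    · have h2 : t * 2 ^ m < d m + 1 := Nat.lt_floor_add_one _
      simp only
      rw [le_div_iff₀ (hpow m), sub_mul, ← mul_pow]
      norm_num
      linarith
    · exact div_le_of_le_mul₀ (hpow m).le ht0 (Nat.floor_le (by positivity))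
  refine le_of_tendsto ((hlim.sub_const (f 0)).abs) (Eventually.of_forall fun m => ?_)
  refine (hsum m).trans (mul_le_mul_of_nonneg_left ?_ hA)
  rw [← tsum_geometric_of_lt_one hr0 hr1]
  exact (summable_geometric_of_lt_one hr0 hr1).sum_le_tsum _ fun _ _ => by positivity

variable {Ω : Type*} [MeasurableSpace Ω] {P : Measure Ω} {H : ℝ} {B : ℝ≥0 → Ω → ℝ}

/-- Absolute moments of centred Gaussian variables scale with the standard deviation. -/
lemma lintegral_abs_div_pow_of_gaussian {X : Ω → ℝ} (hX : HasGaussianLaw X P)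
    (h0 : ∫ ω, X ω ∂P = 0) {σ : ℝ} (hσ : 0 ≤ σ) (h2 : ∫ ω, X ω ^ 2 ∂P = σ ^ 2) {d : ℝ} (hd : 0 < d)
    (p : ℕ) :
    ∫⁻ ω, ENNReal.ofReal ((|X ω| / d) ^ p) ∂P =
      ENNReal.ofReal ((σ / d) ^ p) * ∫⁻ x, ENNReal.ofReal (|x| ^ p) ∂gaussianReal 0 1 := by
  have hlaw : P.map X = (gaussianReal 0 1).map (fun x => σ * x) := by
    rw [hX.map_eq_gaussianReal, h0, variance_of_integral_eq_zero hX.aemeasurable h0, h2,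
      gaussianReal_map_const_mul]
    congr 1
    · simp
    · rw [mul_one]
      ext
      simp [sq_nonneg]
  rw [← lintegral_map' (f := fun x => ENNReal.ofReal ((|x| / d) ^ p)) (by fun_prop) hX.aemeasurable,
    hlaw, lintegral_map (by fun_prop) (by fun_prop), ← lintegral_const_mul _ (by fun_prop)]
  refine lintegral_congr fun x => ?_
  rw [← ENNReal.ofReal_mul (by positivity), abs_mul, abs_of_nonneg hσ, ← mul_pow]
  congr 2
  ring

lemma lintegral_abs_pow_gaussian_ne_top (p : ℕ) :
    ∫⁻ x, ENNReal.ofReal (|x| ^ p) ∂gaussianReal 0 1 ≠ ⊤ := by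
  have h : Integrable (fun x : ℝ => |x| ^ p) (gaussianReal 0 1) :=
    (memLp_id_gaussianReal (μ := 0) (v := 1) (p : ℝ≥0)).integrable_norm_pow'
  rw [← ofReal_integral_eq_lintegral_ofReal h (Eventually.of_forall fun x => by positivity)]
  exact ENNReal.ofReal_ne_top

namespace IsFractionalBrownianMotion

variable (hB : IsFractionalBrownianMotion H B P)
include hB

lemma memLp (t : ℝ≥0) : MemLp (B t) 2 P := (hB.isGaussianProcess.hasGaussianLaw_eval t).memLp_two

lemma integrable_mul (s t : ℝ≥0) : Integrable (fun ω => B s ω * B t ω) P :=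
  (hB.memLp s).integrable_mul (hB.memLp t)

lemma integral_sq (hH : 0 < H) (t : ℝ≥0) : ∫ ω, B t ω ^ 2 ∂P = (t : ℝ) ^ (2 * H) := by
  simp_rw [pow_two]
  rw [hB.covariance, sub_self, abs_zero, Real.zero_rpow (by positivity)]
  ring

lemma integral_sub_sq (hH : 0 < H) (s t : ℝ≥0) :
    ∫ ω, (B s ω - B t ω) ^ 2 ∂P = |(s : ℝ) - t| ^ (2 * H) := by
  have : ∀ ω, (B s ω - B t ω) ^ 2 = B s ω ^ 2 + B t ω ^ 2 - 2 * (B s ω * B t ω) := fun ω => by ring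
  simp_rw [this]
  have hs := (hB.memLp s).integrable_sq
  have ht := (hB.memLp t).integrable_sq
  have hst : Integrable (fun ω => B s ω ^ 2 + B t ω ^ 2) P := hs.add ht
  rw [integral_sub hst ((hB.integrable_mul s t).const_mul 2), integral_add hs ht,
    integral_const_mul, hB.integral_sq hH, hB.integral_sq hH,
    hB.covariance]
  ring

lemma lintegral_sub_pow (hH : 0 < H) (s t : ℝ≥0) {d : ℝ} (hd : 0 < d) (p : ℕ) :
    ∫⁻ ω, ENNReal.ofReal ((|B s ω - B t ω| / d) ^ p) ∂P =
      ENNReal.ofReal ((|(s : ℝ) - t| ^ H / d) ^ p) *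
        ∫⁻ x, ENNReal.ofReal (|x| ^ p) ∂gaussianReal 0 1 := by
  have hi : ∀ t, Integrable (B t) P := fun t => (hB.isGaussianProcess.hasGaussianLaw_eval t).integrable
  refine lintegral_abs_div_pow_of_gaussian hB.isGaussianProcess.hasGaussianLaw_fun_sub ?_
    (by positivity) ?_ hd p
  · rw [integral_sub (hi s) (hi t), hB.centered, hB.centered, sub_zero]
  · rw [hB.integral_sub_sq hH, ← Real.rpow_natCast, ← Real.rpow_mul (abs_nonneg _)]
    push_cast
    ring_nf

omit hB in
-- Summable expectations make the sum almost surely finite, so its terms vanish along `cofinite`: a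
-- Borel–Cantelli argument that needs no ordering of the index set.
lemma ae_tendsto_zero_of_lintegral_le {ι : Type*} [Countable ι] {f : ι → Ω → ENNReal}
    (hf : ∀ i, AEMeasurable (f i) P) {c : ENNReal} (hc : c ≠ ⊤) {F : ι → ℝ} (hF : Summable F)
    (h : ∀ i, ∫⁻ ω, f i ω ∂P ≤ ENNReal.ofReal (F i) * c) :
    ∀ᵐ ω ∂P, Tendsto (fun i => f i ω) cofinite (𝓝 0) := by
  have h1 : ∫⁻ ω, ∑' i, f i ω ∂P ≠ ⊤ := by
    rw [lintegral_tsum hf]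
    refine ne_top_of_le_ne_top ?_ (ENNReal.tsum_le_tsum h)
    rw [ENNReal.tsum_mul_right]
    exact ENNReal.mul_ne_top hF.tsum_ofReal_ne_top hc
  filter_upwards [ae_lt_top' (AEMeasurable.tsum hf) h1] with ω hω
  exact ENNReal.tendsto_cofinite_zero_of_tsum_ne_top hω.ne

/-- Fractional Brownian motion grows sublinearly. -/
theorem ae_sublinear (hH : H ∈ Ioo (0 : ℝ) 1) :
    ∀ᵐ ω ∂P, Tendsto (fun t : ℝ => B t.toNNReal ω / t) atTop (𝓝 0) := by
  have hH0 := hH.1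
  set r : ℝ := (1 / 2) ^ (H / 2) with hr
  have hr0 : 0 < r := by positivity
  have hr1 : r < 1 := Real.rpow_lt_one (by norm_num) (by norm_num) (by positivity)
  -- A level-`m` increment has standard deviation `2 ^ (-m H) = r ^ (2 m)`, so normalising by `r ^
  -- m` leaves `r ^ m`. The three conditions give summability in turn over `n` for dyadic
  -- increments, over `n` for integer times, and over `m` despite the `2 ^ m` increments per level.
  obtain ⟨p, hp2, hpH, hpr⟩ : ∃ p : ℕ, 2 ≤ p ∧ 2 ≤ (1 - H) * p ∧ 2 * r ^ p ≤ 1 / 2 := by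
    have h1 : ∀ᶠ p : ℕ in atTop, 2 / (1 - H) ≤ (p : ℝ) :=
      tendsto_natCast_atTop_atTop.eventually_ge_atTop _
    have h2 : ∀ᶠ p : ℕ in atTop, r ^ p < 1 / 4 :=
      (tendsto_pow_atTop_nhds_zero_of_lt_one hr0.le hr1).eventually (gt_mem_nhds (by norm_num))
    obtain ⟨p, ⟨h3, h4⟩, h5⟩ := ((h1.and h2).and (eventually_ge_atTop 2)).exists
    refine ⟨p, h5, ?_, by linarith⟩
    rwa [div_le_iff₀' (by linarith [hH.2])] at h3
  have hmeas : ∀ (s t : ℝ≥0) (d : ℝ),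
      AEMeasurable (fun ω => ENNReal.ofReal ((|B s ω - B t ω| / d) ^ p)) P := fun s t d => by
    have h1 := hB.isGaussianProcess.aemeasurable s
    have h2 := hB.isGaussianProcess.aemeasurable t
    exact ((((h1.sub h2).abs).div_const d).pow_const p).ennreal_ofReal
  set c := ∫⁻ x, ENNReal.ofReal (|x| ^ p) ∂gaussianReal 0 1
  have hc : c ≠ ⊤ := lintegral_abs_pow_gaussian_ne_top p
  have hsum : Summable fun n : ℕ => 1 / ((n : ℝ) + 1) ^ 2 := by
    have := (summable_nat_add_iff 1).2 (Real.summable_one_div_nat_pow.2 (one_lt_two))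
    simpa using this
  -- values at the integers
  have hE1 : ∀ᵐ ω ∂P, Tendsto (fun n : ℕ =>
      ENNReal.ofReal ((|B n ω - B 0 ω| / ((n : ℝ) + 1)) ^ p)) cofinite (𝓝 0) := by
    refine ae_tendsto_zero_of_lintegral_le (fun n => hmeas n 0 _) hc hsum fun n => ?_
    rw [hB.lintegral_sub_pow hH0 _ _ (by positivity)]
    gcongr
    have hn : (0 : ℝ) < (n : ℝ) + 1 := by positivity
    calc (|((n : ℝ≥0) : ℝ) - ((0 : ℝ≥0) : ℝ)| ^ H / ((n : ℝ) + 1)) ^ p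
        ≤ (((n : ℝ) + 1) ^ H / ((n : ℝ) + 1)) ^ p := by
          gcongr
          simp
      _ = ((n : ℝ) + 1) ^ ((H - 1) * p) := by
          rw [← Real.rpow_sub_one hn.ne', ← Real.rpow_natCast, ← Real.rpow_mul hn.le]
      _ ≤ ((n : ℝ) + 1) ^ (-2 : ℝ) := by
          refine Real.rpow_le_rpow_of_exponent_le (by linarith [n.cast_nonneg (α := ℝ)]) ?_
          linarith
      _ = 1 / ((n : ℝ) + 1) ^ 2 := by
          rw [Real.rpow_neg hn.le, one_div, Real.rpow_two]
  -- dyadic increments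
  have hE2 : ∀ᵐ ω ∂P, Tendsto (fun i : ℕ × ℕ => ∑ k ∈ Finset.range (2 ^ i.2),
      ENNReal.ofReal ((|B (i.1 + (k + 1) / 2 ^ i.2) ω - B (i.1 + k / 2 ^ i.2) ω| /
        (((i.1 : ℝ) + 1) * r ^ i.2)) ^ p)) cofinite (𝓝 0) := by
    refine ae_tendsto_zero_of_lintegral_le (fun i => Finset.aemeasurable_fun_sum _
      fun k _ => hmeas _ _ _) hc (hsum.mul_of_nonneg (summable_geometric_of_lt_one
      (r := (1 / 2 : ℝ)) (by norm_num) (by norm_num)) (fun _ => by positivity)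
      fun _ => by positivity) fun i => ?_
    obtain ⟨n, m⟩ := i
    simp only
    rw [lintegral_finsetSum' _ fun k _ => hmeas _ _ _]
    have hterm : ∀ k ∈ Finset.range (2 ^ m), ∫⁻ ω, ENNReal.ofReal
        ((|B (n + (k + 1) / 2 ^ m) ω - B (n + k / 2 ^ m) ω| / (((n : ℝ) + 1) * r ^ m)) ^ p) ∂P =
        ENNReal.ofReal ((r ^ m / ((n : ℝ) + 1)) ^ p) * c := fun k _ => by
      rw [hB.lintegral_sub_pow hH0 _ _ (by positivity)]
      congr 3
      push_cast
      have h1 : |(n : ℝ) + (k + 1) / 2 ^ m - (n + k / 2 ^ m)| = (1 / 2) ^ m := by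
        rw [show (n : ℝ) + (k + 1) / 2 ^ m - (n + k / 2 ^ m) = (1 / 2) ^ m by
          rw [div_pow, one_pow]; ring]
        exact abs_of_pos (by positivity)
      have h2 : ((1 / 2 : ℝ) ^ m) ^ H = r ^ m * r ^ m := by
        rw [hr, ← Real.rpow_natCast, ← Real.rpow_natCast, ← Real.rpow_mul (by norm_num),
          ← Real.rpow_mul (by norm_num), ← Real.rpow_add (by norm_num)]
        ring_nf
      rw [h1, h2]
      field_simp
    rw [Finset.sum_congr rfl hterm, Finset.sum_const, Finset.card_range, nsmul_eq_mul, ← mul_assoc]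
    gcongr
    rw [← ENNReal.ofReal_natCast, ← ENNReal.ofReal_mul (by positivity)]
    refine ENNReal.ofReal_le_ofReal ?_
    push_cast
    have hn : (1 : ℝ) ≤ (n : ℝ) + 1 := by linarith [n.cast_nonneg (α := ℝ)]
    calc (2 : ℝ) ^ m * (r ^ m / ((n : ℝ) + 1)) ^ p
        = 1 / ((n : ℝ) + 1) ^ p * (2 * r ^ p) ^ m := by
          rw [div_pow, ← pow_mul, mul_comm m p, pow_mul, mul_pow]
          ring
      _ ≤ 1 / ((n : ℝ) + 1) ^ 2 * (1 / 2) ^ m := by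
          gcongr
  filter_upwards [hE1, hE2, hB.continuous_paths] with ω h1 h2 hcont
  set b : ℝ → ℝ := fun t => B t.toNNReal ω with hb
  have hbc : Continuous b := hcont.comp continuous_real_toNNReal
  have hB_b : ∀ s : ℝ≥0, B s ω = b s := fun s => by simp [hb]
  set K : ℝ := 1 + (1 - r)⁻¹ with hK
  have hK0 : 0 < K := by have := sub_pos.2 hr1; positivity
  have hroot : ∀ {a η : ℝ}, 0 < η → 0 ≤ a → ENNReal.ofReal (a ^ p) < ENNReal.ofReal (η ^ p) →
      a ≤ η := fun {a η} hη ha h => by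
    rw [ENNReal.ofReal_lt_ofReal_iff (by positivity)] at h
    exact (lt_of_pow_lt_pow_left₀ p hη.le h).le
  have key : ∀ η : ℝ, 0 < η → ∀ᶠ t : ℝ in atTop, |b t - b 0| ≤ 2 * η * K * t := fun η hη => by
    have hη' : (0 : ENNReal) < ENNReal.ofReal (η ^ p) := ENNReal.ofReal_pos.2 (by positivity)
    have e1 : ∀ᶠ n : ℕ in atTop, |B n ω - B 0 ω| ≤ η * (n + 1) := by
      rw [Nat.cofinite_eq_atTop] at h1
      filter_upwards [h1.eventually (gt_mem_nhds hη')] with n hn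
      have := hroot hη (by positivity) hn
      rwa [div_le_iff₀ (by positivity)] at this
    have e2 : ∀ᶠ n : ℕ in atTop, ∀ m k : ℕ, k < 2 ^ m →
        |B (n + (k + 1) / 2 ^ m) ω - B (n + k / 2 ^ m) ω| ≤ η * (n + 1) * r ^ m := by
      -- Convergence along `cofinite` on pairs leaves finitely many bad `(n, m)`, so beyond some `N`
      -- every level `m` is good at once, as chaining requires.
      have hfin := (h2.eventually (gt_mem_nhds hη')).filter_mono le_rfl
      rw [eventually_cofinite] at hfin
      obtain ⟨N, hN⟩ := (hfin.image Prod.fst).bddAbove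
      filter_upwards [eventually_gt_atTop N] with n hn m k hk
      have hlt : ∑ k ∈ Finset.range (2 ^ m),
          ENNReal.ofReal ((|B (n + (k + 1) / 2 ^ m) ω - B (n + k / 2 ^ m) ω| /
          (((n : ℝ) + 1) * r ^ m)) ^ p) < ENNReal.ofReal (η ^ p) := by
        by_contra hcon
        exact absurd (hN ⟨(n, m), hcon, rfl⟩) (not_le.2 hn)
      have hle := Finset.single_le_sum (f := fun k : ℕ =>
          ENNReal.ofReal ((|B (n + (k + 1) / 2 ^ m) ω - B (n + k / 2 ^ m) ω| /
          (((n : ℝ) + 1) * r ^ m)) ^ p)) (fun _ _ => zero_le) (Finset.mem_range.2 hk)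
      have := hroot hη (by positivity) (hle.trans_lt hlt)
      rw [div_le_iff₀ (by positivity)] at this
      linarith
    filter_upwards [(tendsto_nat_floor_atTop (α := ℝ)).eventually (e1.and e2),
      eventually_ge_atTop 1] with t ht ht1
    set n := ⌊t⌋₊
    have hn1 : (n : ℝ) ≤ t := Nat.floor_le (by linarith)
    have hn2 : t < n + 1 := Nat.lt_floor_add_one t
    have hch := abs_sub_le_of_dyadic (f := fun s => b (n + s)) (by fun_prop)
      (A := η * (n + 1)) (by positivity) hr0.le hr1 (fun m k hk => by
        have := ht.2 m k hk
        rw [hB_b, hB_b] at this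
        push_cast at this
        exact this) (t := t - n) (by linarith) (by linarith)
    have h3 := ht.1
    rw [hB_b, hB_b] at h3
    push_cast at h3
    simp only [add_sub_cancel, add_zero] at hch
    calc |b t - b 0| ≤ |b t - b n| + |b n - b 0| := abs_sub_le _ _ _
      _ ≤ η * (n + 1) * (1 - r)⁻¹ + η * (n + 1) := add_le_add hch h3
      _ = η * K * (n + 1) := by rw [hK]; ring
      _ ≤ η * K * (2 * t) := by
          gcongr
          linarith
      _ = 2 * η * K * t := by ring
  have hlim : Tendsto (fun t => (b t - b 0) / t) atTop (𝓝 0) := by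
    rw [Metric.tendsto_nhds]
    intro ε hε
    filter_upwards [key (ε / (4 * K)) (by positivity), eventually_gt_atTop 0] with t ht ht0
    rw [Real.dist_eq, sub_zero, abs_div, abs_of_pos ht0, div_lt_iff₀ ht0]
    calc |b t - b 0| ≤ 2 * (ε / (4 * K)) * K * t := ht
      _ = ε / 2 * t := by field_simp; norm_num
      _ < ε * t := by nlinarith
  have := hlim.add (tendsto_id.const_div_atTop (b 0))
  rw [zero_add] at this
  refine this.congr fun t => ?_
  simp only [id]
  ring

end IsFractionalBrownianMotion

end Growth

/-! ### A regular modification on the whole line. -/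

/-- The covariance function of fractional Brownian motion. -/
noncomputable def fbmCov (H s t : ℝ) : ℝ :=
  (1 / 2) * (s ^ (2 * H) + t ^ (2 * H) - |s - t| ^ (2 * H))

/-- A fractional Brownian motion, extended by zero to negative times, all of whose paths are
continuous and of sublinear growth. -/
structure IsRegularFBM {Ω : Type*} [MeasurableSpace Ω] (H : ℝ) (W : ℝ → Ω → ℝ)
    (P : Measure Ω) : Prop where
  measurable : ∀ t, Measurable (W t)
  continuous : ∀ ω, Continuous fun t => W t ω
  sublinear : ∀ ω, Tendsto (fun t => W t ω / t) atTop (𝓝 0)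
  eq_zero : ∀ t, t ≤ 0 → ∀ ω, W t ω = 0
  gaussian : IsGaussianProcess W P
  centered : ∀ t, ∫ ω, W t ω ∂P = 0
  covariance : ∀ s t, 0 ≤ s → 0 ≤ t → ∫ ω, W s ω * W t ω ∂P = fbmCov H s t

section Modification

variable {Ω : Type*} [MeasurableSpace Ω] {P : Measure Ω} {H : ℝ} {B : ℝ≥0 → Ω → ℝ}

/-- Setting the process to zero on a measurable null set makes all path properties hold everywhere,
so joint measurability and Fubini become available. -/
lemma IsFractionalBrownianMotion.exists_regular (hB : IsFractionalBrownianMotion H B P)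
    (hH : H ∈ Ioo (0 : ℝ) 1) :
    ∃ W : ℝ → Ω → ℝ, IsRegularFBM H W P ∧ ∀ᵐ ω ∂P, ∀ t : ℝ, W t ω = B t.toNNReal ω := by
  have hm := hB.isGaussianProcess.aemeasurable
  have hae : ∀ᵐ ω ∂P, (Continuous fun t => B t ω) ∧
      Tendsto (fun t : ℝ => B t.toNNReal ω / t) atTop (𝓝 0) ∧ B 0 ω = 0 ∧
      ∀ n m : ℕ, B (n / 2 ^ m) ω = (hm (n / 2 ^ m)).mk _ ω := by
    filter_upwards [hB.continuous_paths, hB.ae_sublinear hH, hB.start_zero,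
      ae_all_iff.2 fun n : ℕ => ae_all_iff.2 fun m : ℕ => (hm (n / 2 ^ m)).ae_eq_mk]
      with ω h1 h2 h3 h4 using ⟨h1, h2, h3, h4⟩
  obtain ⟨N, hN, hNm, hN0⟩ := exists_measurable_superset_of_null (ae_iff.1 hae)
  have hgood : ∀ ω ∈ Nᶜ, (Continuous fun t => B t ω) ∧
      Tendsto (fun t : ℝ => B t.toNNReal ω / t) atTop (𝓝 0) ∧ B 0 ω = 0 ∧
      ∀ n m : ℕ, B (n / 2 ^ m) ω = (hm (n / 2 ^ m)).mk _ ω := fun ω hω => by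
    by_contra hcon
    exact hω (hN hcon)
  set W : ℝ → Ω → ℝ := fun t => Nᶜ.indicator (B t.toNNReal) with hW
  have hWin : ∀ ω ∈ Nᶜ, ∀ t, W t ω = B t.toNNReal ω := fun ω hω t => indicator_of_mem hω _
  have hWout : ∀ ω ∉ Nᶜ, ∀ t, W t ω = 0 := fun ω hω t => indicator_of_notMem hω _
  have hmod : ∀ᵐ ω ∂P, ∀ t : ℝ, W t ω = B t.toNNReal ω := by
    have : Nᶜ ∈ ae P := compl_mem_ae_iff.2 hN0
    filter_upwards [this] with ω hω t using hWin ω hω t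
  have hmod' : ∀ t : ℝ, W t =ᵐ[P] B t.toNNReal := fun t => hmod.mono fun ω h => h t
  refine ⟨W, ⟨fun t => ?_, fun ω => ?_, fun ω => ?_, fun t ht ω => ?_, ?_, fun t => ?_,
    fun s t hs ht => ?_⟩, hmod⟩
  -- Each `B t` is only almost everywhere measurable. Genuine measurability comes from limits of
  -- measurable versions at dyadic times, countable in number and so matched off one null set.
  · have hlim : Tendsto (fun m : ℕ => (⌊(t.toNNReal : ℝ) * 2 ^ m⌋₊ : ℝ≥0) / 2 ^ m) atTop
        (𝓝 t.toNNReal) := by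
      rw [← NNReal.tendsto_coe]
      push_cast
      exact (tendsto_nat_floor_mul_div_atTop (R := ℝ) (NNReal.coe_nonneg _)).comp
        (tendsto_pow_atTop_atTop_of_one_lt (r := (2 : ℝ)) (by norm_num))
    refine measurable_of_tendsto_metrizable
      (f := fun (m : ℕ) => Nᶜ.indicator ((hm (⌊(t.toNNReal : ℝ) * 2 ^ m⌋₊ / 2 ^ m)).mk _))
      (fun m => (AEMeasurable.measurable_mk _).indicator hNm.compl) ?_
    refine tendsto_pi_nhds.2 fun ω => ?_
    by_cases hω : ω ∈ Nᶜ
    · simp only [indicator_of_mem hω]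
      rw [hWin ω hω]
      obtain ⟨h1, -, -, h4⟩ := hgood ω hω
      refine ((h1.tendsto _).comp hlim).congr fun m => ?_
      simp only [Function.comp_apply]
      exact h4 _ _
    · simp only [indicator_of_notMem hω, hWout ω hω]
      exact tendsto_const_nhds
  · by_cases hω : ω ∈ Nᶜ
    · simp only [hWin ω hω]
      exact (hgood ω hω).1.comp continuous_real_toNNReal
    · simp only [hWout ω hω]
      exact continuous_const
  · by_cases hω : ω ∈ Nᶜ
    · simp only [hWin ω hω]
      exact (hgood ω hω).2.1
    · simp only [hWout ω hω, zero_div]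
      exact tendsto_const_nhds
  · by_cases hω : ω ∈ Nᶜ
    · rw [hWin ω hω, Real.toNNReal_of_nonpos ht]
      exact (hgood ω hω).2.2.1
    · exact hWout ω hω t
  · exact (hB.isGaussianProcess.comp_right Real.toNNReal).congr fun t => (hmod' t).symm
  · rw [integral_congr_ae (hmod' t), hB.centered]
  · have : (fun ω => W s ω * W t ω) =ᵐ[P] fun ω => B s.toNNReal ω * B t.toNNReal ω :=
      (hmod' s).mul (hmod' t)
    rw [integral_congr_ae this, hB.covariance, Real.coe_toNNReal s hs, Real.coe_toNNReal t ht]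
    rfl

end Modification

/-! ### Limits of Gaussian variables. -/

section GaussianLimit

variable {Ω : Type*} [MeasurableSpace Ω] {P : Measure Ω}

/-- An almost sure limit of centred Gaussian variables is centred Gaussian. -/
lemma hasLaw_gaussianReal_of_tendsto [IsProbabilityMeasure P] {L : Ω → ℝ} {Ln : ℕ → Ω → ℝ}
    (hg : ∀ n, HasGaussianLaw (Ln n) P) (h0 : ∀ n, ∫ ω, Ln n ω ∂P = 0)
    (hL : AEMeasurable L P) (hlim : ∀ᵐ ω ∂P, Tendsto (fun n => Ln n ω) atTop (𝓝 (L ω))) :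
    HasLaw L (gaussianReal 0 (∫ ω, L ω ^ 2 ∂P).toNNReal) P := by
  set v : ℕ → ℝ := fun n => Var[Ln n; P]
  have hv0 : ∀ n, 0 ≤ v n := fun n => variance_nonneg _ _
  have hdist := tendstoInDistribution_of_ae_tendsto (fun n => (hg n).aemeasurable) hL hlim
  have hprob : IsProbabilityMeasure (P.map L) := Measure.isProbabilityMeasure_map hL
  have hchar : ∀ t : ℝ, Tendsto (fun n => ((Real.exp (-(v n * t ^ 2 / 2)) : ℝ) : ℂ)) atTop
      (𝓝 (charFun (P.map L) t)) := fun t => by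
    have := (ProbabilityMeasure.tendsto_iff_tendsto_charFun.1 hdist.tendsto) t
    refine this.congr fun n => ?_
    simp only [ProbabilityMeasure.coe_mk]
    rw [(hg n).map_eq_gaussianReal, h0, charFun_gaussianReal]
    push_cast
    rw [Real.coe_toNNReal _ (variance_nonneg _ _)]
    simp [v]
  have hre : ∀ t : ℝ, Tendsto (fun n => Real.exp (-(v n * t ^ 2 / 2))) atTop
      (𝓝 (charFun (P.map L) t).re) := fun t => by
    have := (Complex.continuous_re.tendsto _).comp (hchar t)
    exact this.congr fun n => Complex.ofReal_re _
  -- No variance bound is assumed. Near zero the limiting characteristic function is close to one,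
  -- and its logarithm at such a `t₀` forces the variances to converge.
  obtain ⟨t₀, ht₀, hpos⟩ : ∃ t₀ : ℝ, t₀ ≠ 0 ∧ 0 < (charFun (P.map L) t₀).re := by
    have hc : Tendsto (fun t => (charFun (P.map L) t).re) (𝓝[≠] 0) (𝓝 1) := by
      have := (Complex.continuous_re.comp (continuous_charFun (μ := P.map L))).tendsto 0
      simp only [Function.comp_apply, charFun_zero, probReal_univ, Complex.ofReal_one,
        Complex.one_re] at this
      exact this.mono_left nhdsWithin_le_nhds
    obtain ⟨t, h1, h2⟩ := ((hc.eventually (lt_mem_nhds zero_lt_one)).and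
      self_mem_nhdsWithin).exists
    exact ⟨t, h2, h1⟩
  have hvlim : Tendsto v atTop (𝓝 (-2 * Real.log (charFun (P.map L) t₀).re / t₀ ^ 2)) := by
    have := (((hre t₀).log hpos.ne').const_mul (-2)).div_const (t₀ ^ 2)
    refine this.congr fun n => ?_
    rw [Real.log_exp]
    field_simp
  set w := -2 * Real.log (charFun (P.map L) t₀).re / t₀ ^ 2
  have hw0 : 0 ≤ w := ge_of_tendsto' hvlim hv0
  have hmap : P.map L = gaussianReal 0 w.toNNReal := by
    refine Measure.ext_of_charFun (funext fun t => ?_)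
    have h1 : Tendsto (fun n => ((Real.exp (-(v n * t ^ 2 / 2)) : ℝ) : ℂ)) atTop
        (𝓝 ((Real.exp (-(w * t ^ 2 / 2)) : ℝ) : ℂ)) :=
      (Complex.continuous_ofReal.tendsto _).comp
        ((Real.continuous_exp.tendsto _).comp (((hvlim.mul_const _).div_const _).neg))
    rw [tendsto_nhds_unique (hchar t) h1, charFun_gaussianReal]
    push_cast
    rw [Real.coe_toNNReal _ hw0]
    simp
  have hgl : HasGaussianLaw L P := (HasLaw.mk hL hmap).hasGaussianLaw
  have hmean : ∫ ω, L ω ∂P = 0 := by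
    have : ∫ x, x ∂P.map L = 0 := by rw [hmap, integral_id_gaussianReal]
    rwa [integral_map hL (by fun_prop)] at this
  refine ⟨hL, ?_⟩
  rw [hgl.map_eq_gaussianReal, hmean, variance_of_integral_eq_zero hL hmean]

end GaussianLimit

/-! ### Integrals as limits of finite sums of path values. -/

section Riemann

lemma exists_linear_bound {b : ℝ → ℝ} (hb : Continuous b) (hneg : ∀ t, t ≤ 0 → b t = 0)
    (hlin : Tendsto (fun t => b t / t) atTop (𝓝 0)) : ∃ C, 0 ≤ C ∧ ∀ t, |b t| ≤ C * (1 + |t|) := by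
  have hne : ∀ t : ℝ, 1 + |t| ≠ 0 := fun t => by positivity
  have hc : Continuous fun t => b t / (1 + |t|) := by fun_prop (disch := assumption)
  have hl : Tendsto (fun t => b t / (1 + |t|)) atTop (𝓝 0) := by
    refine squeeze_zero_norm' ?_ (by simpa using hlin.abs)
    filter_upwards [eventually_gt_atTop 0] with t ht
    rw [Real.norm_eq_abs, abs_div, abs_div, abs_of_pos (by positivity : 0 < 1 + |t|)]
    have : 0 < |t| := abs_pos.2 ht.ne'
    gcongr
    linarith
  obtain ⟨C, hC0, hC⟩ := exists_bound_of_tendsto hc hl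
  refine ⟨C, hC0, fun t => ?_⟩
  rcases le_total t 0 with ht | ht
  · rw [hneg t ht, abs_zero]
    positivity
  · have := hC t ht
    rwa [abs_div, abs_of_pos (by positivity : 0 < 1 + |t|), div_le_iff₀ (by positivity)] at this

/-- Finitely valued approximations of the identity on the line. -/
noncomputable def idApprox (n : ℕ) : SimpleFunc ℝ ℝ :=
  SimpleFunc.approxOn id measurable_id univ 0 (mem_univ _) n

/-- Riemann-type sums approximating an integral over `ρ`. -/
noncomputable def riemannSum (ρ : Measure ℝ) (n : ℕ) (b : ℝ → ℝ) : ℝ :=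
  ∑ x ∈ (idApprox n).range, ρ.real (idApprox n ⁻¹' {x}) * b x

/-- The sum is the integral of `b ∘ idApprox n`. As `|idApprox n s| ≤ 2 |s|`, the linear bound on
`b` allows dominated convergence. -/
lemma tendsto_riemannSum {ρ : Measure ℝ} [IsFiniteMeasure ρ] (hρ : Integrable (fun s => |s|) ρ)
    {b : ℝ → ℝ} (hb : Continuous b) {C : ℝ} (hC0 : 0 ≤ C) (hC : ∀ t, |b t| ≤ C * (1 + |t|)) :
    Tendsto (fun n => riemannSum ρ n b) atTop (𝓝 (∫ s, b s ∂ρ)) := by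
  have heq : ∀ n, riemannSum ρ n b = ∫ s, b (idApprox n s) ∂ρ := fun n => by
    -- Subtracting `b 0` meets the requirement of `SimpleFunc.map_integral` that zero be sent to
    -- zero; the constant is restored through the total mass.
    have h1 : ((idApprox n).map fun x => b x - b 0).integral ρ =
        ∫ s, (b (idApprox n s) - b 0) ∂ρ :=
      SimpleFunc.integral_eq_integral _ (SimpleFunc.integrable_of_isFiniteMeasure _)
    have hint : Integrable (fun s => b (idApprox n s)) ρ :=
      SimpleFunc.integrable_of_isFiniteMeasure ((idApprox n).map b)
    have h2 : ∑ x ∈ (idApprox n).range, ρ.real (idApprox n ⁻¹' {x}) = ρ.real univ := by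
      simp only [Measure.real]
      rw [← ENNReal.toReal_sum fun _ _ => measure_ne_top _ _,
        SimpleFunc.sum_range_measure_preimage_singleton]
    rw [SimpleFunc.map_integral _ (fun x => b x - b 0)
      (SimpleFunc.integrable_of_isFiniteMeasure _) (sub_self _),
      integral_sub hint (integrable_const _), integral_const] at h1
    simp only [smul_eq_mul, mul_sub, Finset.sum_sub_distrib] at h1
    rw [← Finset.sum_mul, h2] at h1
    simpa [riemannSum] using h1
  simp_rw [heq]
  refine tendsto_integral_of_dominated_convergence (fun s => C * (1 + 2 * |s|)) (fun n => ?_) ?_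
    (fun n => Eventually.of_forall fun s => ?_) (Eventually.of_forall fun s => ?_)
  · exact (hb.measurable.comp (idApprox n).measurable).aestronglyMeasurable
  · exact ((integrable_const _).add (hρ.const_mul 2)).const_mul C
  · refine (hC _).trans ?_
    have h1 := SimpleFunc.edist_approxOn_y0_le measurable_id (mem_univ (0 : ℝ)) s n
    have h2 : |idApprox n s| ≤ 2 * |s| := by
      rw [edist_dist, edist_dist, ← ENNReal.ofReal_add dist_nonneg dist_nonneg,
        ENNReal.ofReal_le_ofReal_iff (by positivity)] at h1
      simp only [Real.dist_eq, zero_sub, abs_neg, id] at h1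
      rw [two_mul]
      exact h1
    gcongr
  · exact (hb.tendsto s).comp
      (SimpleFunc.tendsto_approxOn measurable_id (mem_univ (0 : ℝ)) (by simp))

end Riemann

/-! ### Asymptotics of the covariance function. -/

section CovarianceAsymptotics

open Real

lemma tendsto_sub_shift_of_deriv {f f' : ℝ → ℝ} (hf : ∀ᶠ x in atTop, HasDerivAt f (f' x) x)
    (hf' : Tendsto f' atTop (𝓝 0)) {s : ℝ} (hs : 0 ≤ s) :
    Tendsto (fun x => f x - f (x - s)) atTop (𝓝 0) := by
  rw [Metric.tendsto_nhds]
  intro ε hε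
  have h1 : ∀ᶠ x in atTop, |f' x| < ε / (s + 1) := by
    have := hf'.abs
    rw [abs_zero] at this
    exact this.eventually (gt_mem_nhds (by positivity))
  obtain ⟨X, hX⟩ := eventually_atTop.1 (hf.and h1)
  filter_upwards [eventually_ge_atTop (X + s)] with x hx
  have hbound := (convex_Icc (x - s) x).norm_image_sub_le_of_norm_hasDerivWithin_le
    (f := f) (f' := f') (C := ε / (s + 1))
    (fun y hy => (hX y (by linarith [hy.1])).1.hasDerivWithinAt)
    (fun y hy => (hX y (by linarith [hy.1])).2.le)
    (left_mem_Icc.2 (by linarith)) (right_mem_Icc.2 (by linarith))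
  rw [dist_zero_right]
  refine hbound.trans_lt ?_
  rw [sub_sub_cancel, norm_eq_abs, abs_of_nonneg hs, div_mul_eq_mul_div, div_lt_iff₀ (by positivity)]
  nlinarith

lemma tendsto_rpow_sub_rpow {r : ℝ} (hr : r < 1) {s : ℝ} (hs : 0 ≤ s) :
    Tendsto (fun x : ℝ => x ^ r - (x - s) ^ r) atTop (𝓝 0) := by
  refine tendsto_sub_shift_of_deriv (f := fun x => x ^ r) (f' := fun x => r * x ^ (r - 1)) ?_ ?_ hs
  · filter_upwards [eventually_gt_atTop 0] with x hx
    exact hasDerivAt_rpow_const (Or.inl hx.ne')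
  · have := (tendsto_rpow_neg_atTop (y := 1 - r) (by linarith)).const_mul r
    rw [mul_zero, neg_sub] at this
    exact this

/-- The derivative of a first difference of `x ^ p` is `p` times a first difference of `x ^ (p -
1)`, which vanishes at infinity because `p - 1 < 1`. -/
lemma tendsto_rpow_second_difference {p : ℝ} (hp : p < 2) {s t : ℝ} (hs : 0 ≤ s) (ht : 0 ≤ t) :
    Tendsto (fun x : ℝ => (x ^ p - (x - s) ^ p) - ((x - t) ^ p - (x - t - s) ^ p)) atTop (𝓝 0) := by
  refine tendsto_sub_shift_of_deriv (f := fun x => x ^ p - (x - s) ^ p)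
    (f' := fun x => p * x ^ (p - 1) - p * (x - s) ^ (p - 1)) ?_ ?_ ht
  · filter_upwards [eventually_gt_atTop s] with x hx
    have h1 : HasDerivAt (fun x : ℝ => (x - s) ^ p) (p * (x - s) ^ (p - 1)) x :=
      (hasDerivAt_rpow_const (p := p) (Or.inl (sub_pos.2 hx).ne')).comp_sub_const x s
    exact (hasDerivAt_rpow_const (Or.inl (hs.trans_lt hx).ne')).sub h1
  · have := (tendsto_rpow_sub_rpow (r := p - 1) (by linarith) hs).const_mul p
    rw [mul_zero] at this
    exact this.congr fun x => mul_sub _ _ _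

variable {H : ℝ}

lemma fbmCov_comm (s t : ℝ) : fbmCov H s t = fbmCov H t s := by
  rw [fbmCov, fbmCov, abs_sub_comm]
  ring

lemma fbmCov_self (hH : 0 < H) (t : ℝ) : fbmCov H t t = t ^ (2 * H) := by
  rw [fbmCov, sub_self, abs_zero, zero_rpow (by positivity)]
  ring

lemma fbmCov_of_le {s t : ℝ} (h : s ≤ t) :
    fbmCov H s t = (1 / 2) * (s ^ (2 * H) + t ^ (2 * H) - (t - s) ^ (2 * H)) := by
  rw [fbmCov, abs_sub_comm, abs_of_nonneg (by linarith)]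

lemma tendsto_rpow_mul_fbmCov (hH : H ∈ Ioo (0 : ℝ) 1) {s : ℝ} (hs : 0 ≤ s) :
    Tendsto (fun T : ℝ => T ^ (-H) * fbmCov H s T) atTop (𝓝 0) := by
  have h1 : Tendsto (fun T : ℝ => (1 / 2) * s ^ (2 * H) * T ^ (-H) + |T ^ H - (T - s) ^ H|)
      atTop (𝓝 0) := by
    have := ((tendsto_rpow_neg_atTop hH.1).const_mul ((1 / 2) * s ^ (2 * H))).add
      (tendsto_rpow_sub_rpow hH.2 hs).abs
    simpa using this
  refine squeeze_zero_norm' ?_ h1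
  filter_upwards [eventually_gt_atTop s] with T hT
  have hT0 : 0 < T := hs.trans_lt hT
  have e1 : ∀ x : ℝ, 0 ≤ x → x ^ (2 * H) = x ^ H * x ^ H := fun x hx => by
    rw [two_mul, rpow_add_of_nonneg hx hH.1.le hH.1.le]
  have hle : (T - s) ^ H ≤ T ^ H := rpow_le_rpow (by linarith) (by linarith) hH.1.le
  have hp : 0 < T ^ H := rpow_pos_of_pos hT0 _
  have hp' : 0 ≤ (T - s) ^ H := rpow_nonneg (by linarith) _
  have hsp : 0 ≤ s ^ (2 * H) := rpow_nonneg hs _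
  rw [fbmCov_of_le hT.le, e1 T hT0.le, e1 (T - s) (by linarith), rpow_neg hT0.le,
    abs_of_nonneg (by linarith : 0 ≤ T ^ H - (T - s) ^ H), norm_eq_abs, abs_of_nonneg]
  · rw [← sub_nonneg]
    -- With `X = T ^ H` and `Y = (T - s) ^ H`, `(X ^ 2 - Y ^ 2) / (2 X) ≤ X - Y`, the defect being
    -- `(X - Y) ^ 2 / (2 X)`. This covers all `H < 1` uniformly.
    have : (1 / 2) * s ^ (2 * H) * (T ^ H)⁻¹ + (T ^ H - (T - s) ^ H) -
        (T ^ H)⁻¹ * ((1 / 2) * (s ^ (2 * H) + T ^ H * T ^ H - (T - s) ^ H * (T - s) ^ H)) =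
        (1 / 2) * (T ^ H)⁻¹ * (T ^ H - (T - s) ^ H) ^ 2 := by
      field_simp
      ring
    rw [this]
    positivity
  · have : 0 ≤ T ^ H * T ^ H - (T - s) ^ H * (T - s) ^ H := by nlinarith
    have : 0 ≤ s ^ (2 * H) + T ^ H * T ^ H - (T - s) ^ H * (T - s) ^ H := by linarith
    positivity

/-- Half a second difference of `x ^ (2 H)`, with `2 H < 2`. It makes `ζ_∞` and `Z_T` asymptotically
independent. -/
lemma tendsto_fbmCov_increment (hH : H ∈ Ioo (0 : ℝ) 1) {s t : ℝ} (hs : 0 ≤ s) (ht : 0 ≤ t) :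
    Tendsto (fun T : ℝ => fbmCov H s T - fbmCov H s (T - t)) atTop (𝓝 0) := by
  have h1 := (tendsto_rpow_second_difference (p := 2 * H) (by linarith [hH.2]) hs ht).const_mul
    (1 / 2)
  rw [mul_zero] at h1
  refine h1.congr' ?_
  filter_upwards [eventually_ge_atTop (s + t)] with T hT
  rw [fbmCov_of_le (by linarith), fbmCov_of_le (by linarith)]
  ring

/-- For independent exponential `S`, `S'`, the variables `S`, `S'` and `|S - S'|` share the same `2
H`-th moment, so half of one moment survives; `Γ(2 H + 1) = 2 H Γ(2 H)` turns it into `σ ^ 2`. -/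
lemma integrable_fbmCov_expLaw {θ : ℝ} (hθ : 0 < θ) (hH : 0 < H) :
    Integrable (fun z : ℝ × ℝ => fbmCov H z.1 z.2) ((expLaw θ).prod (expLaw θ)) ∧
    ∫ z, fbmCov H z.1 z.2 ∂(expLaw θ).prod (expLaw θ) = sigmaSq H θ := by
  have := isProbabilityMeasure_expLaw hθ
  have hp : (0 : ℝ) < 2 * H := by positivity
  have hi := integrable_rpow_expLaw hθ (p := 2 * H) (by linarith)
  have hi1 : Integrable (fun z : ℝ × ℝ => z.1 ^ (2 * H)) ((expLaw θ).prod (expLaw θ)) :=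
    hi.comp_fst _
  have hi2 : Integrable (fun z : ℝ × ℝ => z.2 ^ (2 * H)) ((expLaw θ).prod (expLaw θ)) :=
    hi.comp_snd _
  have hc : Continuous fun x : ℝ => x ^ (2 * H) := continuous_rpow_const hp.le
  have hi3 : Integrable (fun z : ℝ × ℝ => |z.1 - z.2| ^ (2 * H)) ((expLaw θ).prod (expLaw θ)) := by
    refine Integrable.mono' (hi1.add hi2) (by fun_prop) ?_
    filter_upwards [Measure.quasiMeasurePreserving_fst.ae (ae_expLaw_pos θ),
      Measure.quasiMeasurePreserving_snd.ae (ae_expLaw_pos θ)] with z hz1 hz2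
    rw [norm_eq_abs, abs_of_nonneg (by positivity)]
    have h1 := rpow_nonneg hz1.le (2 * H)
    have h2 := rpow_nonneg hz2.le (2 * H)
    simp only [Pi.add_apply]
    rcases le_total z.1 z.2 with h | h
    · rw [abs_of_nonpos (by linarith)]
      have := rpow_le_rpow (by linarith : 0 ≤ -(z.1 - z.2)) (by linarith : _ ≤ z.2) hp.le
      linarith
    · rw [abs_of_nonneg (by linarith)]
      have := rpow_le_rpow (by linarith : 0 ≤ z.1 - z.2) (by linarith : _ ≤ z.1) hp.le
      linarith
  have hi12 : Integrable (fun z : ℝ × ℝ => z.1 ^ (2 * H) + z.2 ^ (2 * H))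
    ((expLaw θ).prod (expLaw θ)) := hi1.add hi2
  refine ⟨(hi12.sub hi3).const_mul (1 / 2), ?_⟩
  simp only [fbmCov]
  rw [integral_const_mul, integral_sub hi12 hi3, integral_add hi1 hi2,
    integral_abs_sub_rpow_expLaw hθ hp, integral_fun_fst (μ := expLaw θ) (ν := expLaw θ)
      (fun x => x ^ (2 * H)), integral_fun_snd (μ := expLaw θ) (ν := expLaw θ)
      (fun x => x ^ (2 * H)), integral_rpow_expLaw hθ (by linarith),
    Gamma_add_one hp.ne', sigmaSq]
  simp
  ring

end CovarianceAsymptotics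

/-! ### Gaussian integrals and their variances. -/

section GaussianIntegrals

variable {Ω : Type*} [MeasurableSpace Ω] {P : Measure Ω}

/-- The integral of a Gaussian process against a fixed measure is Gaussian. -/
lemma hasLaw_integral_of_isGaussianProcess [IsProbabilityMeasure P] {ρ : Measure ℝ}
    [IsFiniteMeasure ρ] (hρ : Integrable (fun s => |s|) ρ) {Y : ℝ → Ω → ℝ}
    (hY : IsGaussianProcess Y P) (hm : ∀ s, Measurable (Y s)) (h0 : ∀ s, ∫ ω, Y s ω ∂P = 0)
    (hc : ∀ ω, Continuous fun s => Y s ω)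
    (hb : ∀ ω, ∃ C, 0 ≤ C ∧ ∀ s, |Y s ω| ≤ C * (1 + |s|)) :
    HasLaw (fun ω => ∫ s, Y s ω ∂ρ)
      (gaussianReal 0 (∫ ω, (∫ s, Y s ω ∂ρ) ^ 2 ∂P).toNNReal) P := by
  have huncurry : Measurable (Function.uncurry Y) :=
    measurable_uncurry_of_continuous_of_measurable hc hm
  have hLm : Measurable fun ω => ∫ s, Y s ω ∂ρ :=
    ((huncurry.comp measurable_swap).stronglyMeasurable.integral_prod_right').measurable
  refine hasLaw_gaussianReal_of_tendsto (Ln := fun n ω => riemannSum ρ n fun s => Y s ω)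
    (fun n => ?_) (fun n => ?_) hLm.aemeasurable (Eventually.of_forall fun ω => ?_)
  · simp only [riemannSum]
    exact (hY.smul fun x => ρ.real (idApprox n ⁻¹' {x})).hasGaussianLaw_fun_sum
  · simp only [riemannSum]
    rw [integral_finsetSum _ fun x _ => ((hY.hasGaussianLaw_eval x).integrable).const_mul _]
    exact Finset.sum_eq_zero fun x _ => by rw [integral_const_mul, h0, mul_zero]
  · obtain ⟨C, hC0, hC⟩ := hb ω
    exact tendsto_riemannSum hρ (hc ω) hC0 hC

lemma integral_norm_mul_le {f g : Ω → ℝ} (hf : MemLp f 2 P) (hg : MemLp g 2 P) :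
    ∫ ω, ‖f ω * g ω‖ ∂P ≤ (1 / 2) * (∫ ω, f ω ^ 2 ∂P + ∫ ω, g ω ^ 2 ∂P) := by
  have h : Integrable (fun ω => f ω * g ω) P := hf.integrable_mul hg
  rw [← integral_add hf.integrable_sq hg.integrable_sq, ← integral_const_mul]
  refine integral_mono h.norm ((hf.integrable_sq.add hg.integrable_sq).const_mul _) fun ω => ?_
  simp only [norm_mul, Real.norm_eq_abs]
  nlinarith [sq_nonneg (|f ω| - |g ω|), sq_abs (f ω), sq_abs (g ω)]

/-- The second moment of an integral of a process is the double integral of its covariance. -/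
lemma integral_sq_integral [SFinite P] {ρ : Measure ℝ} [IsProbabilityMeasure ρ]
    {Y : ℝ → Ω → ℝ} (hYm : Measurable (Function.uncurry Y)) (hY2 : ∀ s, MemLp (Y s) 2 P)
    {m : ℝ → ℝ} (hm : Integrable m ρ) (hYm2 : ∀ᵐ s ∂ρ, ∫ ω, Y s ω ^ 2 ∂P ≤ m s) :
    ∫ ω, (∫ s, Y s ω ∂ρ) ^ 2 ∂P = ∫ z, (∫ ω, Y z.1 ω * Y z.2 ω ∂P) ∂ρ.prod ρ := by
  have hmeas : Measurable fun q : (ℝ × ℝ) × Ω => Y q.1.1 q.2 * Y q.1.2 q.2 :=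
    (hYm.comp (by fun_prop : Measurable fun q : (ℝ × ℝ) × Ω => (q.1.1, q.2))).mul
      (hYm.comp (by fun_prop : Measurable fun q : (ℝ × ℝ) × Ω => (q.1.2, q.2)))
  have hprod : ∀ s t, Integrable (fun ω => Y s ω * Y t ω) P := fun s t =>
    (hY2 s).integrable_mul (hY2 t)
  have hint : Integrable (fun q : (ℝ × ℝ) × Ω => Y q.1.1 q.2 * Y q.1.2 q.2)
      ((ρ.prod ρ).prod P) := by
    rw [integrable_prod_iff hmeas.aestronglyMeasurable]
    refine ⟨Eventually.of_forall fun z => hprod z.1 z.2, ?_⟩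
    refine Integrable.mono' (((hm.comp_fst ρ).add (hm.comp_snd ρ)).const_mul (1 / 2))
      (hmeas.norm.stronglyMeasurable.integral_prod_right').aestronglyMeasurable ?_
    filter_upwards [Measure.quasiMeasurePreserving_fst.ae hYm2,
      Measure.quasiMeasurePreserving_snd.ae hYm2] with z hz1 hz2
    rw [Real.norm_eq_abs, abs_of_nonneg (integral_nonneg fun _ => norm_nonneg _)]
    refine (integral_norm_mul_le (hY2 _) (hY2 _)).trans ?_
    simp only [Pi.add_apply]
    gcongr
  rw [integral_integral_swap hint]
  refine integral_congr_ae (Eventually.of_forall fun ω => ?_)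
  simp only
  rw [integral_prod_mul (fun s => Y s ω) (fun s => Y s ω), pow_two]

end GaussianIntegrals

namespace IsRegularFBM

variable {Ω : Type*} [MeasurableSpace Ω] {P : Measure Ω} {H : ℝ} {W : ℝ → Ω → ℝ}
  (hW : IsRegularFBM H W P)
include hW

lemma memLp (t : ℝ) : MemLp (W t) 2 P := (hW.gaussian.hasGaussianLaw_eval t).memLp_two

lemma integrable_mul (s t : ℝ) : Integrable (fun ω => W s ω * W t ω) P :=
  (hW.memLp s).integrable_mul (hW.memLp t)

lemma integrable (t : ℝ) : Integrable (W t) P := (hW.gaussian.hasGaussianLaw_eval t).integrable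

lemma measurable_uncurry : Measurable (Function.uncurry W) :=
  measurable_uncurry_of_continuous_of_measurable hW.continuous hW.measurable

lemma linear_bound (ω : Ω) : ∃ C, 0 ≤ C ∧ ∀ t, |W t ω| ≤ C * (1 + |t|) :=
  exists_linear_bound (hW.continuous ω) (fun t ht => hW.eq_zero t ht ω) (hW.sublinear ω)

lemma integral_sum_mul_sum {ι κ : Type*} [Fintype ι] [Fintype κ] (c : ι → ℝ) (s : ι → ℝ)
    (hs : ∀ i, 0 ≤ s i) (d : κ → ℝ) (t : κ → ℝ) (ht : ∀ j, 0 ≤ t j) :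
    ∫ ω, (∑ i, c i * W (s i) ω) * (∑ j, d j * W (t j) ω) ∂P =
      ∑ i, ∑ j, c i * d j * fbmCov H (s i) (t j) := by
  simp_rw [Finset.sum_mul_sum]
  have hi : ∀ i j, Integrable (fun ω => c i * W (s i) ω * (d j * W (t j) ω)) P := fun i j => by
    refine ((hW.integrable_mul (s i) (t j)).const_mul (c i * d j)).congr
      (Eventually.of_forall fun ω => ?_)
    ring
  rw [integral_finsetSum _ fun i _ => integrable_finsetSum _ fun j _ => hi i j]
  refine Finset.sum_congr rfl fun i _ => ?_
  rw [integral_finsetSum _ fun j _ => hi i j]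
  refine Finset.sum_congr rfl fun j _ => ?_
  rw [← hW.covariance _ _ (hs i) (ht j), ← integral_const_mul]
  congr 1
  ext ω
  ring

end IsRegularFBM

/-! ### Linear combinations of `ζ_∞`, `Z_T` and the scaled noise. -/

/-- The process whose integral against the exponential law is
`a ζ_∞ + b Z_T + c κ W_T`. -/
noncomputable def mixedNoise {Ω : Type*} (W : ℝ → Ω → ℝ) (κ T a b c : ℝ) (s : ℝ) (ω : Ω) : ℝ :=
  a * W s ω + b * (W T ω - W (max (T - s) 0) ω) + c * (κ * W T ω)

/-- The covariance function of `mixedNoise`. -/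
noncomputable def mixedCov (H κ T a b c s t : ℝ) : ℝ :=
  a * a * fbmCov H s t + a * (b + c * κ) * fbmCov H s T - a * b * fbmCov H s (max (T - t) 0)
  + (b + c * κ) * a * fbmCov H T t + (b + c * κ) * (b + c * κ) * fbmCov H T T
  - (b + c * κ) * b * fbmCov H T (max (T - t) 0)
  - b * a * fbmCov H (max (T - s) 0) t - b * (b + c * κ) * fbmCov H (max (T - s) 0) T
  + b * b * fbmCov H (max (T - s) 0) (max (T - t) 0)

lemma mixedNoise_eq_sum {Ω : Type*} (W : ℝ → Ω → ℝ) (κ T a b c s : ℝ) (ω : Ω) :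
    mixedNoise W κ T a b c s ω =
      ∑ i, ![a, b + c * κ, -b] i * W (![s, T, max (T - s) 0] i) ω := by
  simp [Fin.sum_univ_three, mixedNoise]
  ring

/-- Once `T > s + t`, stationarity of increments makes the `b ^ 2` part exactly `fbmCov H s t`
(`e5`), and self-similarity makes the `c ^ 2` part one (`e3`). By time reversal (`e4`) every cross
term involving `c` reduces to `T ^ (-H)` times a covariance with a fixed time; the `a b` terms are
covariances of fixed-time values with increments near `T`. All of these vanish in the limit. -/
lemma tendsto_mixedCov {H : ℝ} (hH : H ∈ Ioo (0 : ℝ) 1) (a b c : ℝ) {s t : ℝ} (hs : 0 ≤ s)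
    (ht : 0 ≤ t) : Tendsto (fun T => mixedCov H (T ^ (-H)) T a b c s t) atTop
      (𝓝 ((a ^ 2 + b ^ 2) * fbmCov H s t + c ^ 2)) := by
  have h1 := (tendsto_fbmCov_increment hH hs ht).const_mul (a * b)
  have h2 := (tendsto_fbmCov_increment hH ht hs).const_mul (a * b)
  have h3 := (tendsto_rpow_mul_fbmCov hH hs).const_mul (a * c + b * c)
  have h4 := (tendsto_rpow_mul_fbmCov hH ht).const_mul (a * c + b * c)
  have h5 := ((h1.add h2).add (h3.add h4)).const_add ((a ^ 2 + b ^ 2) * fbmCov H s t + c ^ 2)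
  simp only [mul_zero, add_zero] at h5
  refine h5.congr' ?_
  filter_upwards [eventually_gt_atTop (s + t)] with T hT
  have hT0 : 0 < T := by linarith
  have e1 : max (T - s) 0 = T - s := max_eq_left (by linarith)
  have e2 : max (T - t) 0 = T - t := max_eq_left (by linarith)
  have e3 : T ^ (-H) * T ^ (-H) * fbmCov H T T = 1 := by
    rw [fbmCov_self hH.1, ← Real.rpow_add hT0, ← Real.rpow_add hT0]
    ring_nf
    simp
  have e4 : ∀ u, 0 ≤ u → u ≤ T → fbmCov H T T - fbmCov H T (T - u) = fbmCov H u T :=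
    fun u hu0 hu => by
      rw [fbmCov_self hH.1, fbmCov_of_le hu, fbmCov_comm T, fbmCov_of_le (by linarith),
        sub_sub_cancel]
      ring
  have e5 : fbmCov H T T - fbmCov H T (T - t) - fbmCov H (T - s) T + fbmCov H (T - s) (T - t) =
      fbmCov H s t := by
    rw [e4 t ht (by linarith), fbmCov_of_le (by linarith : t ≤ T),
      fbmCov_of_le (by linarith : T - s ≤ T), sub_sub_cancel]
    simp only [fbmCov]
    rw [show T - s - (T - t) = -(s - t) by ring, abs_neg]
    ring
  have e4s := e4 s hs (by linarith)
  have e4t := e4 t ht (by linarith)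
  rw [fbmCov_comm T (T - s)] at e4s
  rw [mixedCov, e1, e2, fbmCov_comm T t, fbmCov_comm (T - s) t]
  linear_combination (-b ^ 2) * e5 - b * c * T ^ (-H) * (e4s + e4t) - c ^ 2 * e3

namespace IsRegularFBM

variable {Ω : Type*} [MeasurableSpace Ω] {P : Measure Ω} {H : ℝ} {W : ℝ → Ω → ℝ}
  (hW : IsRegularFBM H W P)
include hW

lemma isGaussianProcess_mixed (κ T a b c : ℝ) : IsGaussianProcess (mixedNoise W κ T a b c) P := by
  classical
  refine hW.gaussian.of_isGaussianProcess fun s => ?_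
  set u := max (T - s) 0
  let I : Finset ℝ := {s, T, u}
  let π : (i : I) → ((I → ℝ) →L[ℝ] ℝ) := fun i => ContinuousLinearMap.proj i
  refine ⟨I, a • π ⟨s, by simp [I]⟩ + b • (π ⟨T, by simp [I]⟩ - π ⟨u, by simp [I]⟩) +
    c • κ • π ⟨T, by simp [I]⟩, fun ω => ?_⟩
  simp [mixedNoise, u, π]

lemma measurable_mixed (κ T a b c s : ℝ) : Measurable (mixedNoise W κ T a b c s) := by
  have h1 := hW.measurable s
  have h2 := hW.measurable T
  have h3 := hW.measurable (max (T - s) 0)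
  unfold mixedNoise
  fun_prop

lemma continuous_mixed (κ T a b c : ℝ) (ω : Ω) :
    Continuous fun s => mixedNoise W κ T a b c s ω := by
  have h1 := hW.continuous ω
  have h2 : Continuous fun s => W (max (T - s) 0) ω :=
    h1.comp (by fun_prop : Continuous fun s : ℝ => max (T - s) 0)
  unfold mixedNoise
  fun_prop

lemma centered_mixed [IsFiniteMeasure P] (κ T a b c s : ℝ) :
    ∫ ω, mixedNoise W κ T a b c s ω ∂P = 0 := by
  simp_rw [mixedNoise_eq_sum]
  rw [integral_finsetSum _ fun i _ => (hW.integrable _).const_mul _]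
  exact Finset.sum_eq_zero fun i _ => by rw [integral_const_mul, hW.centered, mul_zero]

lemma linear_bound_mixed (κ T a b c : ℝ) (ω : Ω) :
    ∃ C, 0 ≤ C ∧ ∀ s, |mixedNoise W κ T a b c s ω| ≤ C * (1 + |s|) := by
  obtain ⟨C, hC0, hC⟩ := hW.linear_bound ω
  refine ⟨|a| * C + |b| * (|W T ω| + C * (1 + |T|)) + |c * (κ * W T ω)|, by positivity,
    fun s => ?_⟩
  have h1 : |W (max (T - s) 0) ω| ≤ C * (1 + |T|) * (1 + |s|) := by
    refine (hC _).trans ?_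
    have : |max (T - s) 0| ≤ |T| + |s| := by
      rw [abs_of_nonneg (le_max_right _ _)]
      exact max_le ((le_abs_self _).trans (abs_sub _ _)) (by positivity)
    rw [mul_assoc]
    gcongr
    nlinarith [abs_nonneg T, abs_nonneg s, mul_nonneg (abs_nonneg T) (abs_nonneg s)]
  have hs1 : 1 ≤ 1 + |s| := by linarith [abs_nonneg s]
  calc |mixedNoise W κ T a b c s ω|
      ≤ |a| * |W s ω| + |b| * (|W T ω| + |W (max (T - s) 0) ω|) + |c * (κ * W T ω)| := by
        rw [mixedNoise]
        refine (abs_add_le _ _).trans (add_le_add_left ((abs_add_le _ _).trans ?_) _)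
        rw [abs_mul, abs_mul]
        gcongr
        exact abs_sub _ _
    _ ≤ |a| * (C * (1 + |s|)) + |b| * (|W T ω| * (1 + |s|) + C * (1 + |T|) * (1 + |s|)) +
        |c * (κ * W T ω)| * (1 + |s|) := by
        gcongr
        · exact hC s
        · exact le_mul_of_one_le_right (abs_nonneg _) hs1
        · exact le_mul_of_one_le_right (abs_nonneg _) hs1
    _ = _ := by ring

lemma integral_mixed_mul_mixed {κ T a b c s t : ℝ} (hT : 0 ≤ T) (hs : 0 ≤ s) (ht : 0 ≤ t) :
    ∫ ω, mixedNoise W κ T a b c s ω * mixedNoise W κ T a b c t ω ∂P =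
      mixedCov H κ T a b c s t := by
  simp_rw [mixedNoise_eq_sum]
  rw [hW.integral_sum_mul_sum]
  · simp [Fin.sum_univ_three, mixedCov]
    ring
  · intro i
    fin_cases i <;> simp [hs, hT]
  · intro i
    fin_cases i <;> simp [ht, hT]

/-- The bound is free of `T`: the clamped increment spans at most `s`, and the scaled noise has unit
variance. It serves both Fubini and dominated convergence. -/
lemma integral_mixed_sq_le (hH : 0 < H) {T a b c s : ℝ} (hT : 0 < T) (hs : 0 ≤ s) :
    ∫ ω, mixedNoise W (T ^ (-H)) T a b c s ω ^ 2 ∂P ≤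
      3 * ((a ^ 2 + b ^ 2) * s ^ (2 * H) + c ^ 2) := by
  set u := max (T - s) 0
  have hu : 0 ≤ u := le_max_right _ _
  have hTu : |T - u| ≤ s := by
    rcases le_total s T with h | h
    · rw [show u = T - s from max_eq_left (by linarith), sub_sub_cancel, abs_of_nonneg hs]
    · rw [show u = 0 from max_eq_right (by linarith), sub_zero, abs_of_pos hT]
      exact h
  have i1 := (hW.memLp s).integrable_sq
  have i2 : Integrable (fun ω => (W T ω - W u ω) ^ 2) P :=
    ((hW.memLp T).sub (hW.memLp u)).integrable_sq
  have i3 := (hW.memLp T).integrable_sq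
  have e1 : ∀ t, 0 ≤ t → ∫ ω, W t ω ^ 2 ∂P = t ^ (2 * H) := fun t ht => by
    simp_rw [pow_two]
    rw [hW.covariance t t ht ht, fbmCov_self hH]
  have e2 : ∫ ω, (W T ω - W u ω) ^ 2 ∂P = |T - u| ^ (2 * H) := by
    have : ∀ ω, (W T ω - W u ω) ^ 2 = W T ω ^ 2 + W u ω ^ 2 - 2 * (W T ω * W u ω) :=
      fun ω => by ring
    have i4 : Integrable (fun ω => W T ω ^ 2 + W u ω ^ 2) P := i3.add (hW.memLp u).integrable_sq
    simp_rw [this]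
    rw [integral_sub i4 ((hW.integrable_mul T u).const_mul 2),
      integral_add i3 (hW.memLp u).integrable_sq, integral_const_mul, e1 T hT.le, e1 u hu,
      hW.covariance T u hT.le hu, fbmCov]
    ring
  have hκ : (T ^ (-H)) ^ 2 * T ^ (2 * H) = 1 := by
    rw [pow_two, ← Real.rpow_add hT, ← Real.rpow_add hT]
    ring_nf
    simp
  have i5 : Integrable (fun ω => a ^ 2 * W s ω ^ 2 + b ^ 2 * (W T ω - W u ω) ^ 2) P :=
    (i1.const_mul _).add (i2.const_mul _)
  calc ∫ ω, mixedNoise W (T ^ (-H)) T a b c s ω ^ 2 ∂P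
      ≤ ∫ ω, 3 * (a ^ 2 * W s ω ^ 2 + b ^ 2 * (W T ω - W u ω) ^ 2 +
          (c ^ 2 * (T ^ (-H)) ^ 2) * W T ω ^ 2) ∂P := by
        refine integral_mono_of_nonneg (Eventually.of_forall fun ω => sq_nonneg _)
          ((i5.add (i3.const_mul _)).const_mul 3) (Eventually.of_forall fun ω => ?_)
        simp only [mixedNoise]
        nlinarith [sq_nonneg (a * W s ω - b * (W T ω - W u ω)),
          sq_nonneg (a * W s ω - c * (T ^ (-H) * W T ω)),
          sq_nonneg (b * (W T ω - W u ω) - c * (T ^ (-H) * W T ω))]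
    _ = 3 * (a ^ 2 * s ^ (2 * H) + b ^ 2 * |T - u| ^ (2 * H) + c ^ 2) := by
        rw [integral_const_mul, integral_add i5 (i3.const_mul _), integral_add (i1.const_mul _)
          (i2.const_mul _), integral_const_mul, integral_const_mul, integral_const_mul,
          e1 s hs, e1 T hT.le, e2, mul_assoc (c ^ 2), hκ, mul_one]
    _ ≤ 3 * ((a ^ 2 + b ^ 2) * s ^ (2 * H) + c ^ 2) := by
        have : |T - u| ^ (2 * H) ≤ s ^ (2 * H) :=
          Real.rpow_le_rpow (abs_nonneg _) hTu (by positivity)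
        nlinarith [mul_le_mul_of_nonneg_left this (sq_nonneg b)]

end IsRegularFBM

lemma sigmaSq_pos {H θ : ℝ} (hH : 0 < H) (hθ : 0 < θ) : 0 < sigmaSq H θ := by
  have := Real.Gamma_pos_of_pos (by positivity : 0 < 2 * H)
  unfold sigmaSq
  positivity

lemma continuous_fbmCov {H : ℝ} (hH : 0 < H) : Continuous fun z : ℝ × ℝ => fbmCov H z.1 z.2 := by
  have hc : Continuous fun x : ℝ => x ^ (2 * H) := Real.continuous_rpow_const (by positivity)
  unfold fbmCov
  fun_prop

lemma continuous_mixedCov {H : ℝ} (hH : 0 < H) (κ T a b c : ℝ) :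
    Continuous fun z : ℝ × ℝ => mixedCov H κ T a b c z.1 z.2 := by
  have h := continuous_fbmCov hH
  have h' : ∀ f g : ℝ × ℝ → ℝ, Continuous f → Continuous g →
      Continuous fun z => fbmCov H (f z) (g z) := fun f g hf hg => h.comp (hf.prodMk hg)
  have h1 := h' (fun z => z.1) (fun _ => T) (by fun_prop) (by fun_prop)
  have h2 := h' (fun z => z.1) (fun z => max (T - z.2) 0) (by fun_prop) (by fun_prop)
  have h3 := h' (fun _ => T) (fun z => z.2) (by fun_prop) (by fun_prop)
  have h4 := h' (fun _ => T) (fun z => max (T - z.2) 0) (by fun_prop) (by fun_prop)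
  have h5 := h' (fun z => max (T - z.1) 0) (fun z => z.2) (by fun_prop) (by fun_prop)
  have h6 := h' (fun z => max (T - z.1) 0) (fun _ => T) (by fun_prop) (by fun_prop)
  have h7 := h' (fun z => max (T - z.1) 0) (fun z => max (T - z.2) 0) (by fun_prop) (by fun_prop)
  unfold mixedCov
  fun_prop

/-- The variance of `a ζ_∞ + b Z_T + c T ^ (-H) W_T`. -/
noncomputable def mixedVar (H θ a b c T : ℝ) : ℝ :=
  ∫ z, mixedCov H (T ^ (-H)) T a b c z.1 z.2 ∂(expLaw θ).prod (expLaw θ)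

lemma integrable_abs_expLaw {θ : ℝ} (hθ : 0 < θ) : Integrable (fun s => |s|) (expLaw θ) := by
  have := integrable_rpow_expLaw hθ (p := 1) (by norm_num)
  simp only [Real.rpow_one] at this
  exact this.norm

namespace IsRegularFBM

variable {Ω : Type*} [MeasurableSpace Ω] {P : Measure Ω} {H θ : ℝ} {W : ℝ → Ω → ℝ}
  (hW : IsRegularFBM H W P)
include hW

lemma memLp_mixed (κ T a b c s : ℝ) : MemLp (mixedNoise W κ T a b c s) 2 P :=
  ((hW.isGaussianProcess_mixed κ T a b c).hasGaussianLaw_eval s).memLp_two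

lemma hasLaw_mixed [IsProbabilityMeasure P] (hH : 0 < H) (hθ : 0 < θ) {T : ℝ} (hT : 0 < T)
    (a b c : ℝ) :
    HasLaw (fun ω => ∫ s, mixedNoise W (T ^ (-H)) T a b c s ω ∂expLaw θ)
      (gaussianReal 0 (mixedVar H θ a b c T).toNNReal) P := by
  have := isProbabilityMeasure_expLaw hθ
  have h1 := hasLaw_integral_of_isGaussianProcess (integrable_abs_expLaw hθ)
    (hW.isGaussianProcess_mixed (T ^ (-H)) T a b c) (hW.measurable_mixed _ _ _ _ _)
    (hW.centered_mixed _ _ _ _ _) (hW.continuous_mixed _ _ _ _ _)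
    (hW.linear_bound_mixed _ _ _ _ _)
  convert h1 using 3
  have hm : Integrable (fun s : ℝ => 3 * ((a ^ 2 + b ^ 2) * s ^ (2 * H) + c ^ 2)) (expLaw θ) :=
    (((integrable_rpow_expLaw hθ (by linarith)).const_mul _).add (integrable_const _)).const_mul 3
  rw [integral_sq_integral (measurable_uncurry_of_continuous_of_measurable
    (hW.continuous_mixed _ _ _ _ _) (hW.measurable_mixed _ _ _ _ _)) (hW.memLp_mixed _ _ _ _ _) hm
    ((ae_expLaw_pos θ).mono fun s hs => hW.integral_mixed_sq_le hH hT hs.le), mixedVar]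
  refine integral_congr_ae ?_
  filter_upwards [Measure.quasiMeasurePreserving_fst.ae (ae_expLaw_pos θ),
    Measure.quasiMeasurePreserving_snd.ae (ae_expLaw_pos θ)] with z hz1 hz2
  rw [hW.integral_mixed_mul_mixed hT.le hz1.le hz2.le]

lemma tendsto_mixedVar (hH : H ∈ Ioo (0 : ℝ) 1) (hθ : 0 < θ) (a b c : ℝ) :
    Tendsto (mixedVar H θ a b c) atTop (𝓝 ((a ^ 2 + b ^ 2) * sigmaSq H θ + c ^ 2)) := by
  have := isProbabilityMeasure_expLaw hθ
  obtain ⟨hi, hv⟩ := integrable_fbmCov_expLaw (H := H) hθ hH.1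
  have hlim : (a ^ 2 + b ^ 2) * sigmaSq H θ + c ^ 2 =
      ∫ z, ((a ^ 2 + b ^ 2) * fbmCov H z.1 z.2 + c ^ 2) ∂(expLaw θ).prod (expLaw θ) := by
    rw [integral_add (hi.const_mul _) (integrable_const _), integral_const_mul, hv]
    simp
  rw [hlim]
  have hm : Integrable (fun s : ℝ => 3 * ((a ^ 2 + b ^ 2) * s ^ (2 * H) + c ^ 2)) (expLaw θ) :=
    (((integrable_rpow_expLaw hθ (by linarith [hH.1])).const_mul _).add
      (integrable_const _)).const_mul 3
  refine tendsto_integral_filter_of_dominated_convergence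
    (fun z => (1 / 2) * (3 * ((a ^ 2 + b ^ 2) * z.1 ^ (2 * H) + c ^ 2) +
      3 * ((a ^ 2 + b ^ 2) * z.2 ^ (2 * H) + c ^ 2)))
    (Eventually.of_forall fun T => (continuous_mixedCov hH.1 _ _ _ _ _).aestronglyMeasurable) ?_
    (((hm.comp_fst _).add (hm.comp_snd _)).const_mul _) ?_
  · filter_upwards [eventually_gt_atTop 0] with T hT
    filter_upwards [Measure.quasiMeasurePreserving_fst.ae (ae_expLaw_pos θ),
      Measure.quasiMeasurePreserving_snd.ae (ae_expLaw_pos θ)] with z hz1 hz2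
    rw [← hW.integral_mixed_mul_mixed hT.le hz1.le hz2.le]
    refine (norm_integral_le_integral_norm _).trans
      ((integral_norm_mul_le (hW.memLp_mixed _ _ _ _ _ _) (hW.memLp_mixed _ _ _ _ _ _)).trans ?_)
    gcongr
    · exact hW.integral_mixed_sq_le hH.1 hT hz1.le
    · exact hW.integral_mixed_sq_le hH.1 hT hz2.le
  · filter_upwards [Measure.quasiMeasurePreserving_fst.ae (ae_expLaw_pos θ),
      Measure.quasiMeasurePreserving_snd.ae (ae_expLaw_pos θ)] with z hz1 hz2
    exact tendsto_mixedCov hH a b c hz1.le hz2.le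

/-- The case `a = 1`, `b = c = 0`, where the mixed variance does not depend on `T` and so equals its
limit. -/
lemma hasLaw_zetaPath [IsProbabilityMeasure P] (hH : H ∈ Ioo (0 : ℝ) 1) (hθ : 0 < θ) :
    HasLaw (fun ω => zetaPath θ fun s => W s ω) (gaussianReal 0 (sigmaSq H θ).toNNReal) P := by
  have := isProbabilityMeasure_expLaw hθ
  have h1 : ∀ T : ℝ, 0 < T → HasLaw (fun ω => zetaPath θ fun s => W s ω)
      (gaussianReal 0 (mixedVar H θ 1 0 0 T).toNNReal) P := fun T hT => by
    have := hW.hasLaw_mixed hH.1 hθ hT 1 0 0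
    refine this.congr (Eventually.of_forall fun ω => ?_)
    beta_reduce
    rw [zetaPath_eq_integral_expLaw hθ]
    simp [mixedNoise]
  have h2 := hW.tendsto_mixedVar hH hθ 1 0 0
  have h3 : mixedVar H θ 1 0 0 =ᶠ[atTop] fun _ => mixedVar H θ 1 0 0 1 := by
    filter_upwards [eventually_gt_atTop 0] with T hT
    simp [mixedVar, mixedCov]
  have h4 := tendsto_nhds_unique (h2.congr' h3) tendsto_const_nhds
  have h5 := h1 1 one_pos
  rw [← h4] at h5
  simpa using h5

/-- `a ζ_∞ + b Z_T + c T ^ (-H) W_T` as an integral against the exponential law. -/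
lemma integral_mixed_eq (hθ : 0 < θ) {T : ℝ} (hT : 0 ≤ T) (κ a b c : ℝ) (ω : Ω) :
    ∫ s, mixedNoise W κ T a b c s ω ∂expLaw θ =
      a * zetaPath θ (fun s => W s ω) + b * ouPath θ (fun s => W s ω) T + c * (κ * W T ω) := by
  have := isProbabilityMeasure_expLaw hθ
  have i1 : Integrable (fun s => a * W s ω) (expLaw θ) :=
    (integrable_expLaw_of_sublinear hθ (hW.continuous ω) (hW.sublinear ω)).const_mul a
  have i2 : Integrable (fun s => b * (W T ω - W (max (T - s) 0) ω)) (expLaw θ) :=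
    ((integrable_const _).sub (integrable_expLaw_max hθ (hW.continuous ω) hT)).const_mul b
  have i12 : Integrable (fun s => a * W s ω + b * (W T ω - W (max (T - s) 0) ω)) (expLaw θ) :=
    i1.add i2
  rw [zetaPath_eq_integral_expLaw hθ, ouPath_eq_integral_expLaw hθ (hW.continuous ω)
    (hW.eq_zero 0 le_rfl ω) hT]
  simp only [mixedNoise]
  rw [integral_add i12 (integrable_const _), integral_add i1 i2, integral_const_mul,
    integral_const_mul]
  simp

end IsRegularFBM

/-! ### Tools for convergence in distribution. -/

section Distribution

variable {Ω Ω' : Type*} [MeasurableSpace Ω] [MeasurableSpace Ω'] {P : Measure Ω} {P' : Measure Ω'}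
  [IsProbabilityMeasure P] [IsProbabilityMeasure P']

/-- Continuous mapping theorem for a function continuous at almost every point of the limit. -/
theorem tendstoInDistribution_comp_of_ae_continuousAt {ι E F : Type*} {l : Filter ι}
    [l.IsCountablyGenerated]
    [TopologicalSpace E] [MeasurableSpace E] [BorelSpace E] [HasOuterApproxClosed E]
    [TopologicalSpace F] [MeasurableSpace F] [BorelSpace F]
    {X : ι → Ω → E} {Z : Ω' → E} {g : E → F}
    (h : TendstoInDistribution X l Z (fun _ => P) P') (hg : Measurable g)
    (hgZ : ∀ᵐ ω ∂P', ContinuousAt g (Z ω)) :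
    TendstoInDistribution (fun i ω => g (X i ω)) l (fun ω => g (Z ω)) (fun _ => P) P' where
  forall_aemeasurable i := hg.comp_aemeasurable (h.forall_aemeasurable i)
  aemeasurable_limit := hg.comp_aemeasurable h.aemeasurable_limit
  tendsto := by
    refine tendsto_of_forall_isClosed_limsup_le' fun F hF => ?_
    -- Portmanteau for the closure of the preimage: at a continuity point of `g`, belonging to that
    -- closure already forces the value into `F`.
    have h1 := ProbabilityMeasure.limsup_measure_closed_le_of_tendsto h.tendsto
      (isClosed_closure (s := g ⁻¹' F))
    simp only [ProbabilityMeasure.coe_mk] at h1 ⊢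
    have hgX : ∀ i, AEMeasurable (fun ω => g (X i ω)) P :=
      fun i => hg.comp_aemeasurable (h.forall_aemeasurable i)
    have hgm : AEMeasurable (fun ω => g (Z ω)) P' := hg.comp_aemeasurable h.aemeasurable_limit
    rw [Measure.map_apply_of_aemeasurable hgm hF.measurableSet]
    refine (limsup_le_limsup (Eventually.of_forall fun i => ?_)).trans (h1.trans ?_)
    · rw [Measure.map_apply_of_aemeasurable (hgX i) hF.measurableSet, Measure.map_apply_of_aemeasurable (h.forall_aemeasurable i)
        isClosed_closure.measurableSet]
      exact measure_mono fun ω hω => subset_closure hω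
    · rw [Measure.map_apply_of_aemeasurable h.aemeasurable_limit isClosed_closure.measurableSet]
      refine measure_mono_ae ?_
      filter_upwards [hgZ] with ω hω hcl
      by_contra hn
      have hnhds : g ⁻¹' Fᶜ ∈ 𝓝 (Z ω) := hω (hF.isOpen_compl.mem_nhds hn)
      obtain ⟨y, hy1, hy2⟩ := mem_closure_iff_nhds.1 hcl _ hnhds
      exact hy1 hy2

/-- Convergence in distribution along `l` follows from that along sequences tending to `l`. -/
lemma tendstoInDistribution_of_seq {ι E : Type*} {l : Filter ι} [l.IsCountablyGenerated]
    [TopologicalSpace E] [MeasurableSpace E] [OpensMeasurableSpace E]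
    {X : ι → Ω → E} {Z : Ω' → E} (hX : ∀ i, AEMeasurable (X i) P) (hZ : AEMeasurable Z P')
    (h : ∀ u : ℕ → ι, Tendsto u atTop l →
      TendstoInDistribution (fun n => X (u n)) atTop Z (fun _ => P) P') :
    TendstoInDistribution X l Z (fun _ => P) P' :=
  ⟨hX, hZ, tendsto_of_seq_tendsto fun u hu => (h u hu).tendsto⟩

lemma aemeasurable_vec_three {Q : Measure Ω} {f g k : Ω → ℝ}
    (hf : AEMeasurable f Q) (hg : AEMeasurable g Q) (hk : AEMeasurable k Q) :
    AEMeasurable (fun ω => (!₂[f ω, g ω, k ω] : EuclideanSpace ℝ (Fin 3))) Q := by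
  refine (PiLp.continuous_toLp 2 fun _ : Fin 3 => ℝ).measurable.comp_aemeasurable
    (aemeasurable_pi_lambda _ fun i => ?_)
  fin_cases i
  exacts [hf, hg, hk]

lemma charFun_map_vec_three {Q : Measure Ω} {f g k : Ω → ℝ}
    (hf : AEMeasurable f Q) (hg : AEMeasurable g Q) (hk : AEMeasurable k Q)
    (t : EuclideanSpace ℝ (Fin 3)) :
    charFun (Q.map fun ω => (!₂[f ω, g ω, k ω] : EuclideanSpace ℝ (Fin 3))) t =
      charFun (Q.map fun ω => t 0 * f ω + t 1 * g ω + t 2 * k ω) 1 := by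
  rw [charFun_apply, charFun_apply_real, integral_map (aemeasurable_vec_three hf hg hk)
    (by fun_prop), integral_map (by fun_prop) (by fun_prop)]
  congr 1 with ω
  simp [PiLp.inner_apply, Fin.sum_univ_three, mul_comm]

/-- **Cramér–Wold** criterion for three random variables. -/
theorem tendstoInDistribution_of_tendsto_charFun_linear {X Y Z : ℕ → Ω → ℝ} {X' Y' Z' : Ω' → ℝ}
    (hX : ∀ n, AEMeasurable (X n) P) (hY : ∀ n, AEMeasurable (Y n) P)
    (hZ : ∀ n, AEMeasurable (Z n) P) (hX' : AEMeasurable X' P') (hY' : AEMeasurable Y' P')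
    (hZ' : AEMeasurable Z' P')
    (h : ∀ a b c : ℝ, Tendsto
      (fun n => charFun (P.map fun ω => a * X n ω + b * Y n ω + c * Z n ω) 1) atTop
      (𝓝 (charFun (P'.map fun ω => a * X' ω + b * Y' ω + c * Z' ω) 1))) :
    TendstoInDistribution (fun n ω => (X n ω, Y n ω, Z n ω)) atTop (fun ω => (X' ω, Y' ω, Z' ω))
      (fun _ => P) P' := by
  have key : TendstoInDistribution
      (fun n ω => (!₂[X n ω, Y n ω, Z n ω] : EuclideanSpace ℝ (Fin 3))) atTop
      (fun ω => !₂[X' ω, Y' ω, Z' ω]) (fun _ => P) P' := by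
    refine ⟨fun n => aemeasurable_vec_three (hX n) (hY n) (hZ n), aemeasurable_vec_three hX' hY' hZ',
      ProbabilityMeasure.tendsto_iff_tendsto_charFun.2 fun t => ?_⟩
    simp only [ProbabilityMeasure.coe_mk]
    rw [charFun_map_vec_three hX' hY' hZ']
    exact (h (t 0) (t 1) (t 2)).congr fun n => (charFun_map_vec_three (hX n) (hY n) (hZ n) t).symm
  have hcont : Continuous fun v : EuclideanSpace ℝ (Fin 3) => (v 0, v 1, v 2) := by fun_prop
  exact key.continuous_comp hcont

/-- Slutsky's theorem for the pair `(A Q + o(1), C U + F Q + o(1))` with `F = o(1)`. -/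
theorem tendstoInDistribution_slutsky_pair {Q U V R A C F : ℕ → Ω → ℝ} {Q' U' : Ω' → ℝ} {a c : ℝ}
    (h : TendstoInDistribution (fun n ω => (Q n ω, U n ω)) atTop (fun ω => (Q' ω, U' ω))
      (fun _ => P) P')
    (hV : ∀ n, AEMeasurable (V n) P) (hR : ∀ n, AEMeasurable (R n) P)
    (hA : ∀ n, AEMeasurable (A n) P) (hC : ∀ n, AEMeasurable (C n) P)
    (hF : ∀ n, AEMeasurable (F n) P)
    (hlim : ∀ᵐ ω ∂P, Tendsto (A · ω) atTop (𝓝 a) ∧ Tendsto (C · ω) atTop (𝓝 c) ∧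
      Tendsto (F · ω) atTop (𝓝 0) ∧ Tendsto (fun n => V n ω - A n ω * Q n ω) atTop (𝓝 0) ∧
      Tendsto (fun n => R n ω - (C n ω * U n ω + F n ω * Q n ω)) atTop (𝓝 0)) :
    TendstoInDistribution (fun n ω => (V n ω, R n ω)) atTop (fun ω => (a * Q' ω, c * U' ω))
      (fun _ => P) P' := by
  have hQ : ∀ n, AEMeasurable (Q n) P := fun n => (h.forall_aemeasurable n).fst
  have hU : ∀ n, AEMeasurable (U n) P := fun n => (h.forall_aemeasurable n).snd
  set Y : ℕ → Ω → ℝ × ℝ × ℝ × ℝ × ℝ := fun n ω => (A n ω, C n ω, F n ω,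
    V n ω - A n ω * Q n ω, R n ω - (C n ω * U n ω + F n ω * Q n ω)) with hY
  have hYm : ∀ n, AEMeasurable (Y n) P := fun n =>
    (hA n).prodMk ((hC n).prodMk ((hF n).prodMk (((hV n).sub ((hA n).mul (hQ n))).prodMk
      ((hR n).sub (((hC n).mul (hU n)).add ((hF n).mul (hQ n)))))))
  have hYt : TendstoInMeasure P Y atTop fun _ => (a, c, 0, 0, 0) :=
    tendstoInMeasure_of_tendsto_ae (fun n => (hYm n).aestronglyMeasurable)
      (hlim.mono fun ω hω => hω.1.prodMk_nhds (hω.2.1.prodMk_nhds (hω.2.2.1.prodMk_nhds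
        (hω.2.2.2.1.prodMk_nhds hω.2.2.2.2))))
  have hg : Continuous fun p : (ℝ × ℝ) × (ℝ × ℝ × ℝ × ℝ × ℝ) =>
      (p.2.1 * p.1.1 + p.2.2.2.2.1,
        p.2.2.1 * p.1.2 + p.2.2.2.1 * p.1.1 + p.2.2.2.2.2) := by fun_prop
  have := TendstoInDistribution.continuous_comp_prodMk_of_tendstoInMeasure_const hg h hYt hYm
  refine this.congr (fun n => Eventually.of_forall fun ω => ?_) (Eventually.of_forall fun ω => ?_)
  · simp [hY]
  · simp

end Distribution

/-! ### The joint Gaussian limit. -/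

section Limit

variable {Ω Ω' : Type*} [MeasurableSpace Ω] [MeasurableSpace Ω'] {P : Measure Ω} {P' : Measure Ω'}

/-- With `v = σ ^ 2` this variance is the limit found in `tendsto_mixedVar`; their agreement for all
`a b c` identifies the limiting triple. -/
lemma hasLaw_linear_three [IsProbabilityMeasure P'] {ζ N₁ N₂ : Ω' → ℝ} {v : ℝ} (hv : 0 ≤ v)
    (hζ : HasLaw ζ (gaussianReal 0 v.toNNReal) P') (h₁ : HasLaw N₁ (gaussianReal 0 1) P')
    (h₂ : HasLaw N₂ (gaussianReal 0 1) P') (h₁₂ : IndepFun N₁ N₂ P')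
    (hind : IndepFun ζ (fun ω => (N₁ ω, N₂ ω)) P') (a b c : ℝ) :
    HasLaw (fun ω => a * ζ ω + b * (√v * N₂ ω) + c * N₁ ω)
      (gaussianReal 0 ((a ^ 2 + b ^ 2) * v + c ^ 2).toNNReal) P' := by
  have hi1 : IndepFun (fun ω => (b * √v) * N₂ ω) (fun ω => c * N₁ ω) P' :=
    h₁₂.symm.comp (φ := fun x => (b * √v) * x) (ψ := fun x => c * x) (by fun_prop) (by fun_prop)
  have hi2 : IndepFun (fun ω => a * ζ ω) (fun ω => (b * √v) * N₂ ω + c * N₁ ω) P' :=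
    hind.comp (φ := fun x => a * x) (ψ := fun x : ℝ × ℝ => (b * √v) * x.2 + c * x.1)
      (by fun_prop) (by fun_prop)
  have hs := gaussianReal_add_gaussianReal_of_indepFun hi1
    (gaussianReal_const_mul h₂ (b * √v)).map_eq (gaussianReal_const_mul h₁ c).map_eq
  have ht := gaussianReal_add_gaussianReal_of_indepFun hi2
    (gaussianReal_const_mul hζ a).map_eq hs
  have hζm := hζ.aemeasurable
  have h1m := h₁.aemeasurable
  have h2m := h₂.aemeasurable
  refine ⟨by fun_prop, ?_⟩
  convert ht using 2
  · ext ω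
    simp only [Pi.add_apply]
    ring
  · simp
  · ext
    rw [Real.coe_toNNReal _ (by positivity)]
    simp only [NNReal.coe_add, NNReal.coe_mul, Real.coe_toNNReal _ hv, NNReal.coe_one]
    simp only [NNReal.coe_mk, mul_pow, Real.sq_sqrt hv]
    ring

lemma measurable_intervalIntegral {f : ℝ → Ω → ℝ} (hf : Measurable (Function.uncurry f))
    (a b : ℝ) : Measurable fun ω => ∫ s in a..b, f s ω := by
  have h : ∀ ρ : Measure ℝ, [SFinite ρ] → Measurable fun ω => ∫ s, f s ω ∂ρ := fun ρ _ =>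
    ((hf.comp measurable_swap).stronglyMeasurable.integral_prod_right').measurable
  exact (h _).sub (h _)

namespace IsRegularFBM

variable {H θ : ℝ} {W : ℝ → Ω → ℝ} (hW : IsRegularFBM H W P)
include hW

lemma measurable_ouPath (θ T : ℝ) : Measurable fun ω => ouPath θ (fun s => W s ω) T := by
  have h := measurable_intervalIntegral (f := fun s ω => Real.exp (θ * s) * W s ω)
    ((Real.continuous_exp.measurable.comp (measurable_fst.const_mul θ)).mul
      hW.measurable_uncurry) 0 T
  exact (hW.measurable T).sub ((h.const_mul _).const_mul _)

lemma measurable_vasicekPath (θ μ t : ℝ) :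
    Measurable fun ω => vasicekPath θ μ (fun s => W s ω) t := by
  have h := measurable_intervalIntegral (f := fun s ω => Real.exp (-θ * s) * W s ω)
    ((Real.continuous_exp.measurable.comp (measurable_fst.const_mul (-θ))).mul
      hW.measurable_uncurry) 0 t
  exact ((hW.measurable t).const_add _).add (h.const_mul _)

lemma measurable_uncurry_vasicekPath (θ μ : ℝ) :
    Measurable (Function.uncurry fun t ω => vasicekPath θ μ (fun s => W s ω) t) := by
  refine measurable_uncurry_of_continuous_of_measurable (fun ω => ?_)
    (hW.measurable_vasicekPath θ μ)
  have hb := hW.continuous ω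
  have h : Continuous fun t => ∫ s in (0 : ℝ)..t, Real.exp (-θ * s) * W s ω :=
    intervalIntegral.continuous_primitive
      (fun a b => Continuous.intervalIntegrable (by fun_prop) a b) 0
  unfold vasicekPath
  fun_prop

/-- Joint convergence in law of `ζ_∞`, the Ornstein–Uhlenbeck integral and the noise. -/
theorem tendstoInDistribution_triple [IsProbabilityMeasure P] [IsProbabilityMeasure P']
    (hH : H ∈ Ioo (0 : ℝ) 1) (hθ : 0 < θ)
    {ζ N₁ N₂ : Ω' → ℝ} (hζ : HasLaw ζ (gaussianReal 0 (sigmaSq H θ).toNNReal) P')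
    (h₁ : HasLaw N₁ (gaussianReal 0 1) P') (h₂ : HasLaw N₂ (gaussianReal 0 1) P')
    (h₁₂ : IndepFun N₁ N₂ P') (hind : IndepFun ζ (fun ω => (N₁ ω, N₂ ω)) P')
    {u : ℕ → ℝ} (hu : Tendsto u atTop atTop) :
    TendstoInDistribution (fun n ω => (zetaPath θ (fun s => W s ω),
        ouPath θ (fun s => W s ω) (u n), u n ^ (-H) * W (u n) ω)) atTop
      (fun ω => (ζ ω, √(sigmaSq H θ) * N₂ ω, N₁ ω)) (fun _ => P) P' := by
  refine tendstoInDistribution_of_tendsto_charFun_linear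
    (fun _ => (hW.hasLaw_zetaPath hH hθ).aemeasurable)
    (fun n => (hW.measurable_ouPath θ (u n)).aemeasurable)
    (fun n => ((hW.measurable (u n)).const_mul _).aemeasurable) hζ.aemeasurable
    (h₂.aemeasurable.const_mul _) h₁.aemeasurable fun a b c => ?_
  -- Both sides are centred Gaussian, so convergence of characteristic functions reduces to that of
  -- the variances.
  rw [(hasLaw_linear_three (sigmaSq_pos hH.1 hθ).le hζ h₁ h₂ h₁₂ hind a b c).map_eq,
    charFun_gaussianReal]
  have hlim : Tendsto (fun n => charFun (gaussianReal 0 (mixedVar H θ a b c (u n)).toNNReal) 1)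
      atTop (𝓝 (Complex.exp ((1 : ℝ) * (0 : ℝ) * Complex.I -
        (((a ^ 2 + b ^ 2) * sigmaSq H θ + c ^ 2).toNNReal : ℝ) * (1 : ℝ) ^ 2 / 2))) := by
    simp only [charFun_gaussianReal]
    have hc : Continuous fun v : ℝ => Complex.exp ((1 : ℝ) * (0 : ℝ) * Complex.I -
        ((v.toNNReal : ℝ) : ℂ) * (1 : ℝ) ^ 2 / 2) := by fun_prop
    exact (hc.tendsto _).comp ((hW.tendsto_mixedVar hH hθ a b c).comp hu)
  refine hlim.congr' ?_
  filter_upwards [hu.eventually_gt_atTop 0] with n hn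
  rw [← (hW.hasLaw_mixed hH.1 hθ hn a b c).map_eq]
  simp only [hW.integral_mixed_eq hθ hn.le]

/-- Since `σ ^ 2 > 0`, the Gaussian law of `ζ_∞` has no atom at `-μ`. -/
lemma ae_add_zetaPath_ne_zero (hH : H ∈ Ioo (0 : ℝ) 1) (hθ : 0 < θ) [IsProbabilityMeasure P]
    (μ : ℝ) : ∀ᵐ ω ∂P, μ + zetaPath θ (fun s => W s ω) ≠ 0 := by
  have h := hW.hasLaw_zetaPath hH hθ
  have hne : (sigmaSq H θ).toNNReal ≠ 0 := (Real.toNNReal_pos.2 (sigmaSq_pos hH.1 hθ)).ne'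
  have := nullSingletonClass_gaussianReal (μ := 0) hne
  have h2 : ∀ᵐ z ∂gaussianReal 0 (sigmaSq H θ).toNNReal, z ≠ -μ := by
    rw [ae_iff]
    simp
  rw [← h.map_eq] at h2
  filter_upwards [ae_of_ae_map h.aemeasurable h2] with ω hω h0
  exact hω (by linarith)

/-- The limit of `(Z_T / (μ + ζ_∞), T ^ (-H) W_T)`. -/
theorem tendstoInDistribution_quotient [IsProbabilityMeasure P] [IsProbabilityMeasure P']
    (hH : H ∈ Ioo (0 : ℝ) 1) (hθ : 0 < θ) (μ : ℝ)
    {ζ N₁ N₂ : Ω' → ℝ} (hζ : HasLaw ζ (gaussianReal 0 (sigmaSq H θ).toNNReal) P')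
    (h₁ : HasLaw N₁ (gaussianReal 0 1) P') (h₂ : HasLaw N₂ (gaussianReal 0 1) P')
    (h₁₂ : IndepFun N₁ N₂ P') (hind : IndepFun ζ (fun ω => (N₁ ω, N₂ ω)) P')
    (hne : ∀ᵐ ω ∂P', μ + ζ ω ≠ 0) {u : ℕ → ℝ} (hu : Tendsto u atTop atTop) :
    TendstoInDistribution (fun n ω => (ouPath θ (fun s => W s ω) (u n) /
        (μ + zetaPath θ (fun s => W s ω)), u n ^ (-H) * W (u n) ω)) atTop
      (fun ω => (√(sigmaSq H θ) * N₂ ω / (μ + ζ ω), N₁ ω)) (fun _ => P) P' :=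
  tendstoInDistribution_comp_of_ae_continuousAt
    (g := fun p : ℝ × ℝ × ℝ => (p.2.1 / (μ + p.1), p.2.2))
    (hW.tendstoInDistribution_triple hH hθ hζ h₁ h₂ h₁₂ hind hu) (by fun_prop)
    (hne.mono fun ω hω => by
      refine ContinuousAt.prodMk (ContinuousAt.div ?_ ?_ hω) ?_ <;> fun_prop)

end IsRegularFBM

end Limit

/-! ### Measurability of the estimators and their joint limit law. -/

section Estimators

variable {Ω Ω' : Type*} [MeasurableSpace Ω] [MeasurableSpace Ω'] {P : Measure Ω} {P' : Measure Ω'}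

namespace IsRegularFBM

variable {H θ μ : ℝ} {W x : ℝ → Ω → ℝ} (hW : IsRegularFBM H W P)
  (hx : ∀ᵐ ω ∂P, IsVasicekPath θ μ (fun s => W s ω) (fun s => x s ω))
include hx

/-- No measurability of the solution is assumed; this formula is where it, and that of the
estimators, comes from. -/
lemma ae_eq_vasicekPath :
    ∀ᵐ ω ∂P, ∀ t, 0 ≤ t → x t ω = vasicekPath θ μ (fun s => W s ω) t := by
  filter_upwards [hx] with ω h t ht
  exact h.solves.eq_vasicekPath h.continuous_noise h.continuous_path ht

include hW

lemma aemeasurable_path {T : ℝ} (hT : 0 ≤ T) : AEMeasurable (x T) P :=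
  (hW.measurable_vasicekPath θ μ T).aemeasurable.congr
    ((ae_eq_vasicekPath hx).mono fun _ h => (h T hT).symm)

lemma aemeasurable_integral {T : ℝ} (hT : 0 ≤ T) :
    AEMeasurable (fun ω => ∫ s in (0 : ℝ)..T, x s ω) P := by
  refine (measurable_intervalIntegral
    (hW.measurable_uncurry_vasicekPath θ μ) 0 T).aemeasurable.congr ?_
  filter_upwards [ae_eq_vasicekPath hx] with ω h
  refine intervalIntegral.integral_congr fun s hs => ?_
  rw [uIcc_of_le hT] at hs
  exact (h s hs.1).symm

lemma aemeasurable_sq_integral {T : ℝ} (hT : 0 ≤ T) :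
    AEMeasurable (fun ω => ∫ s in (0 : ℝ)..T, x s ω ^ 2) P := by
  refine (measurable_intervalIntegral (f := fun s ω => vasicekPath θ μ (fun s => W s ω) s ^ 2)
    ((hW.measurable_uncurry_vasicekPath θ μ).pow_const 2) 0 T).aemeasurable.congr ?_
  filter_upwards [ae_eq_vasicekPath hx] with ω h
  refine intervalIntegral.integral_congr fun s hs => ?_
  rw [uIcc_of_le hT] at hs
  exact congrArg (· ^ 2) (h s hs.1).symm

lemma aemeasurable_pathDisc {T : ℝ} (hT : 0 ≤ T) :
    AEMeasurable (fun ω => pathDisc (fun s => x s ω) T) P :=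
  ((hW.aemeasurable_sq_integral hx hT).const_mul T).sub
    ((hW.aemeasurable_integral hx hT).pow_const 2)

lemma aemeasurable_thetaPath {T : ℝ} (hT : 0 ≤ T) :
    AEMeasurable (fun ω => thetaPath (fun s => x s ω) T) P :=
  ((((hW.aemeasurable_path hx hT).pow_const 2).const_mul _).sub
    ((hW.aemeasurable_path hx hT).mul (hW.aemeasurable_integral hx hT))).div
    (hW.aemeasurable_pathDisc hx hT)

lemma aemeasurable_alphaPath {T : ℝ} (hT : 0 ≤ T) :
    AEMeasurable (fun ω => alphaPath (fun s => x s ω) T) P :=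
  (((hW.aemeasurable_path hx hT).mul (hW.aemeasurable_sq_integral hx hT)).sub
    ((((hW.aemeasurable_path hx hT).pow_const 2).const_mul _).mul
      (hW.aemeasurable_integral hx hT))).div (hW.aemeasurable_pathDisc hx hT)

lemma aemeasurable_muPath {T : ℝ} (hT : 0 ≤ T) :
    AEMeasurable (fun ω => muPath (fun s => x s ω) T) P :=
  ((hW.aemeasurable_sq_integral hx hT).sub
    (((hW.aemeasurable_path hx hT).const_mul _).mul (hW.aemeasurable_integral hx hT))).div
    (((hW.aemeasurable_path hx hT).const_mul _).sub (hW.aemeasurable_integral hx hT))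

lemma aemeasurable_muDenom {T : ℝ} (hT : 0 ≤ T) :
    AEMeasurable (fun ω => muDenom θ (fun s => x s ω) T) P :=
  (((hW.aemeasurable_integral hx hT).div
    ((hW.aemeasurable_path hx hT).const_mul T)).const_sub _).const_mul _

lemma aemeasurable_muFactor {T : ℝ} (hT : 0 ≤ T) :
    AEMeasurable (fun ω => muFactor θ (fun s => x s ω) T) P :=
  (hW.aemeasurable_muDenom hx hT).const_div _

variable [IsProbabilityMeasure P]

lemma aemeasurable_thetaFactor (hH : H ∈ Ioo (0 : ℝ) 1) (hθ : 0 < θ) {T : ℝ} (hT : 0 ≤ T) :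
    AEMeasurable (fun ω => thetaFactor θ μ (fun s => W s ω) (fun s => x s ω) T) P :=
  (((hW.hasLaw_zetaPath hH hθ).aemeasurable.const_add μ).pow_const 2).mul
    ((hW.aemeasurable_pathDisc hx hT).const_div _)

lemma aemeasurable_muOuFactor (hH : H ∈ Ioo (0 : ℝ) 1) (hθ : 0 < θ) {T : ℝ} (hT : 0 ≤ T) :
    AEMeasurable (fun ω => muOuFactor θ μ (fun s => W s ω) (fun s => x s ω) T) P :=
  ((((hW.hasLaw_zetaPath hH hθ).aemeasurable.const_add μ).pow_const 2).neg.mul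
    ((hW.aemeasurable_path hx hT).const_div _)).div (hW.aemeasurable_muDenom hx hT)

/-- Joint limit law of the estimator of `θ` and of an estimator `e` of `m` having an expansion
`T (e_T - m) = C_T W_T + F_T Z_T / (μ + ζ_∞) + o(1)`. -/
theorem tendstoInDistribution_pair [IsProbabilityMeasure P'] (hH : H ∈ Ioo (0 : ℝ) 1) (hθ : 0 < θ)
    {ζ N₁ N₂ : Ω' → ℝ} (hζ : HasLaw ζ (gaussianReal 0 (sigmaSq H θ).toNNReal) P')
    (h₁ : HasLaw N₁ (gaussianReal 0 1) P') (h₂ : HasLaw N₂ (gaussianReal 0 1) P')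
    (h₁₂ : IndepFun N₁ N₂ P') (hind : IndepFun ζ (fun ω => (N₁ ω, N₂ ω)) P')
    (hne : ∀ᵐ ω ∂P', μ + ζ ω ≠ 0) {u : ℕ → ℝ} (hu0 : ∀ n, 0 ≤ u n) (hu : Tendsto u atTop atTop)
    {e C F : ℝ → Ω → ℝ} {m c : ℝ}
    (he : ∀ T, 0 ≤ T → AEMeasurable (e T) P) (hC : ∀ T, 0 ≤ T → AEMeasurable (C T) P)
    (hF : ∀ T, 0 ≤ T → AEMeasurable (F T) P)
    (hexp : ∀ᵐ ω ∂P, Tendsto (C · ω) atTop (𝓝 c) ∧ (∃ f, Tendsto (F · ω) atTop (𝓝 f)) ∧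
      Tendsto (fun T => T * (e T ω - m) - (C T ω * W T ω + F T ω *
        (ouPath θ (fun s => W s ω) T / (μ + zetaPath θ (fun s => W s ω))))) atTop (𝓝 0)) :
    TendstoInDistribution (fun n ω =>
        (Real.exp (θ * u n) * (thetaPath (fun s => x s ω) (u n) - θ),
          u n ^ (1 - H) * (e (u n) ω - m))) atTop
      (fun ω => (2 * θ * √(sigmaSq H θ) * N₂ ω / (μ + ζ ω), c * N₁ ω)) (fun _ => P) P' := by
  have hpow : Tendsto (fun T : ℝ => T ^ (-H)) atTop (𝓝 0) := tendsto_rpow_neg_atTop hH.1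
  have key := tendstoInDistribution_slutsky_pair (a := 2 * θ) (c := c)
    (V := fun n ω => Real.exp (θ * u n) * (thetaPath (fun s => x s ω) (u n) - θ))
    (R := fun n ω => u n ^ (1 - H) * (e (u n) ω - m))
    (A := fun n ω => thetaFactor θ μ (fun s => W s ω) (fun s => x s ω) (u n))
    (C := fun n => C (u n)) (F := fun n ω => u n ^ (-H) * F (u n) ω)
    (hW.tendstoInDistribution_quotient hH hθ μ hζ h₁ h₂ h₁₂ hind hne hu)
    (fun n => ((hW.aemeasurable_thetaPath hx (hu0 n)).sub_const θ).const_mul _)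
    (fun n => ((he _ (hu0 n)).sub_const m).const_mul _)
    (fun n => hW.aemeasurable_thetaFactor hx hH hθ (hu0 n))
    (fun n => hC _ (hu0 n)) (fun n => (hF _ (hu0 n)).const_mul _) ?_
  · refine key.congr (fun n => Eventually.of_forall fun ω => rfl)
      (Eventually.of_forall fun ω => ?_)
    simp only [Prod.mk.injEq, and_true]
    ring
  · filter_upwards [hx, hexp, hW.ae_add_zetaPath_ne_zero hH hθ μ] with ω h ⟨hc, ⟨f, hf⟩, hr⟩ hM
    refine ⟨(h.tendsto_thetaFactor hM).comp hu, hc.comp hu, ?_,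
      (h.tendsto_thetaPath_expansion hM).comp hu, ?_⟩
    -- Passing from the scale `T` to `T ^ (1 - H)` multiplies the expansion by `T ^ (-H)`, which
    -- kills the bounded coefficient of `Z_T / (μ + ζ_∞)`.
    · have h1 := (hpow.mul hf).comp hu
      rwa [zero_mul] at h1
    · have h1 := (hpow.mul hr).comp hu
      rw [mul_zero] at h1
      refine h1.congr' ?_
      filter_upwards [hu.eventually_gt_atTop 0] with n hn
      simp only [Function.comp_apply]
      rw [sub_eq_add_neg 1 H, Real.rpow_add hn, Real.rpow_one]
      ring

end IsRegularFBM

end Estimators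

/-! ### Independence of `ζ_∞` and the limiting normals. -/

section Independence

variable {Ω Ω' : Type*} [MeasurableSpace Ω] [MeasurableSpace Ω'] {P : Measure Ω} {P' : Measure Ω'}

lemma iIndepFun_vec_three [IsProbabilityMeasure P'] {ζ N₁ N₂ : Ω' → ℝ}
    (h₁₂ : IndepFun N₁ N₂ P') (hind : IndepFun ζ (fun ω => (N₁ ω, N₂ ω)) P') :
    iIndepFun ![ζ, N₁, N₂] P' := by
  classical
  rw [iIndepFun_iff_measure_inter_preimage_eq_mul]
  intro S A hA
  -- Padding the missing coordinates with `univ` replaces a case analysis over subsets of `Fin 3` by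
  -- the full triple.
  set D : Fin 3 → Set ℝ := fun i => if i ∈ S then A i else univ with hD
  have hDm : ∀ i, MeasurableSet (D i) := fun i => by
    by_cases hi : i ∈ S
    · simpa [hD, hi] using hA i hi
    · simp [hD, hi]
  have h1 : (⋂ i ∈ S, ![ζ, N₁, N₂] i ⁻¹' A i) =
      ζ ⁻¹' D 0 ∩ (fun ω => (N₁ ω, N₂ ω)) ⁻¹' (D 1 ×ˢ D 2) := by
    have : (⋂ i ∈ S, ![ζ, N₁, N₂] i ⁻¹' A i) = ⋂ i, ![ζ, N₁, N₂] i ⁻¹' D i := by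
      refine iInter_congr fun i => ?_
      by_cases hi : i ∈ S <;> simp [hD, hi]
    rw [this]
    ext ω
    simp [Fin.forall_fin_succ]
  have h2 : ∏ i ∈ S, P' (![ζ, N₁, N₂] i ⁻¹' A i) = ∏ i, P' (![ζ, N₁, N₂] i ⁻¹' D i) := by
    rw [← Finset.prod_subset S.subset_univ fun i _ hi => by simp [hD, hi]]
    exact Finset.prod_congr rfl fun i hi => by simp [hD, hi]
  rw [h1, h2, hind.measure_inter_preimage_eq_mul _ _ (hDm 0) ((hDm 1).prod (hDm 2)),
    mk_preimage_prod, h₁₂.measure_inter_preimage_eq_mul _ _ (hDm 1) (hDm 2), Fin.prod_univ_three]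
  simp [mul_assoc]

/-- `ζ_∞` is, almost surely, a measurable functional of the path. -/
lemma exists_measurable_zetaPath {H θ : ℝ} (hθ : 0 < θ) {W : ℝ → Ω → ℝ}
    (hW : IsRegularFBM H W P) : ∃ Φ : (ℝ≥0 → ℝ) → ℝ, Measurable Φ ∧
      ∀ ω, Φ (fun t => W t ω) = zetaPath θ fun s => W s ω := by
  have := isProbabilityMeasure_expLaw hθ
  -- Each Riemann sum reads finitely many coordinates, so the `limsup` is measurable on the whole
  -- product space, without any path regularity.
  refine ⟨fun w => limsup (fun n => riemannSum (expLaw θ) n fun s => w s.toNNReal) atTop,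
    Measurable.limsup fun n => ?_, fun ω => ?_⟩
  · unfold riemannSum
    fun_prop
  · obtain ⟨C, hC0, hC⟩ := hW.linear_bound ω
    have h0 : (fun s : ℝ => W (s.toNNReal : ℝ) ω) = fun s => W s ω := by
      funext s
      rcases le_total 0 s with hs | hs
      · rw [Real.coe_toNNReal _ hs]
      · rw [Real.toNNReal_of_nonpos hs, hW.eq_zero s hs, NNReal.coe_zero, hW.eq_zero 0 le_rfl]
    simp only [h0]
    rw [zetaPath_eq_integral_expLaw hθ]
    exact (tendsto_riemannSum (integrable_abs_expLaw hθ) (hW.continuous ω) hC0 hC).limsup_eq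

end Independence

/-! ### Passage from the stated objects to the pathwise ones. -/

section Bridge

variable {Ω Ω' : Type*} [MeasurableSpace Ω] [MeasurableSpace Ω'] {P : Measure Ω} {P' : Measure Ω'}

lemma thetaEst_eq (x : ℝ≥0 → ℝ) (T : ℝ≥0) :
    thetaEst x T = thetaPath (fun s => x s.toNNReal) T := by
  simp [thetaEst, thetaPath, pathDisc, pathIntegral, pathSqIntegral]

lemma alphaEst_eq (x : ℝ≥0 → ℝ) (T : ℝ≥0) :
    alphaEst x T = alphaPath (fun s => x s.toNNReal) T := by
  simp [alphaEst, alphaPath, pathDisc, pathIntegral, pathSqIntegral]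

lemma muEst_eq (x : ℝ≥0 → ℝ) (T : ℝ≥0) :
    muEst x T = muPath (fun s => x s.toNNReal) T := by
  simp [muEst, muPath, pathIntegral, pathSqIntegral]

lemma IsVasicekSolution.ae_isVasicekPath {H θ μ : ℝ} {B X : ℝ≥0 → Ω → ℝ} {W : ℝ → Ω → ℝ}
    (hX : IsVasicekSolution θ μ B X P) (hθ : 0 < θ) (hW : IsRegularFBM H W P)
    (hWB : ∀ᵐ ω ∂P, ∀ t : ℝ, W t ω = B t.toNNReal ω) :
    ∀ᵐ ω ∂P, IsVasicekPath θ μ (fun s => W s ω) (fun s => X s.toNNReal ω) := by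
  filter_upwards [hX, hWB] with ω hω hB
  refine ⟨hθ, hW.continuous ω, hW.sublinear ω, hω.1.comp continuous_real_toNNReal,
    fun t ht => ?_⟩
  have h := hω.2.2 t.toNNReal
  rw [Real.coe_toNNReal t ht] at h
  rw [h, hB t]

variable {H θ μ : ℝ} {B : ℝ≥0 → Ω → ℝ} {W : ℝ → Ω → ℝ}

lemma ae_zetaInf_eq (hWB : ∀ᵐ ω ∂P, ∀ t : ℝ, W t ω = B t.toNNReal ω) :
    ∀ᵐ ω ∂P, zetaPath θ (fun s => W s ω) = zetaInf θ B ω := by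
  filter_upwards [hWB] with ω hω
  simp only [zetaPath, zetaInf, hω]

lemma indepFun_zetaInf [IsProbabilityMeasure P'] (hθ : 0 < θ) (hW : IsRegularFBM H W P)
    (hWB : ∀ᵐ ω ∂P, ∀ t : ℝ, W t ω = B t.toNNReal ω) {π : Ω' → Ω}
    (hπ : MeasurePreserving π P' P) {N : Ω' → ℝ × ℝ}
    (hind : IndepFun N (fun ω (t : ℝ≥0) => B t (π ω)) P') :
    IndepFun (fun ω => zetaInf θ B (π ω)) N P' := by
  obtain ⟨Φ, hΦ, hΦW⟩ := exists_measurable_zetaPath hθ hW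
  refine (hind.symm.comp hΦ measurable_id).congr ?_ (Eventually.of_forall fun _ => rfl)
  filter_upwards [hπ.quasiMeasurePreserving.ae (ae_zetaInf_eq (θ := θ) hWB),
    hπ.quasiMeasurePreserving.ae hWB] with ω h1 h2
  simp only [Function.comp_apply]
  rw [← h1, ← hΦW]
  simp [h2]

end Bridge

end FractionalVasicek

/-! ### Assembly of the theorem. -/

theorem mainTheorem3 {Ω : Type*} [MeasurableSpace Ω] (P : Measure Ω) [IsProbabilityMeasure P]
    (H : ℝ) (hH : H ∈ Ioo (0 : ℝ) 1) (θ : ℝ) (hθ : 0 < θ) (μ : ℝ)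
    (B X : ℝ≥0 → Ω → ℝ)
    (hB : FractionalVasicek.IsFractionalBrownianMotion H B P)
    (hX : FractionalVasicek.IsVasicekSolution θ μ B X P) :
    -- strong consistency
    (∀ᵐ ω ∂P, Tendsto (fun T : ℝ≥0 => (FractionalVasicek.thetaEst (fun t => X t ω) T,
        FractionalVasicek.muEst (fun t => X t ω) T)) atTop (𝓝 (θ, μ))) ∧
    (∀ᵐ ω ∂P, Tendsto (fun T : ℝ≥0 => (FractionalVasicek.thetaEst (fun t => X t ω) T,
        FractionalVasicek.alphaEst (fun t => X t ω) T)) atTop (𝓝 (θ, μ * θ))) ∧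
    -- `ζ_∞` is well defined and has law `N(0, σ ^ 2)`
    (∀ᵐ ω ∂P, IntegrableOn (fun s : ℝ => Real.exp (-θ * s) * B s.toNNReal ω) (Ioi 0)) ∧
    HasLaw (FractionalVasicek.zetaInf θ B)
      (gaussianReal 0 (FractionalVasicek.sigmaSq H θ).toNNReal) P ∧
    -- joint limits in law; `N₁`, `N₂` live on an extension `π : Ω' → Ω` of the probability space
    -- (`π = id` is allowed), where `N₁`, `N₂` and the process `B` are mutually independent
    (∀ {Ω' : Type*} [MeasurableSpace Ω'] (P' : Measure Ω') [IsProbabilityMeasure P']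
      (π : Ω' → Ω) (N₁ N₂ : Ω' → ℝ), MeasurePreserving π P' P →
      HasLaw N₁ (gaussianReal 0 1) P' → HasLaw N₂ (gaussianReal 0 1) P' →
      IndepFun N₁ N₂ P' →
      IndepFun (fun ω => (N₁ ω, N₂ ω)) (fun ω (t : ℝ≥0) => B t (π ω)) P' →
      iIndepFun ![fun ω => FractionalVasicek.zetaInf θ B (π ω), N₁, N₂] P' ∧
      TendstoInDistribution
        (fun (T : ℝ≥0) ω =>
          (Real.exp (θ * T) * (FractionalVasicek.thetaEst (fun t => X t ω) T - θ),
            (T : ℝ) ^ (1 - H) * (FractionalVasicek.muEst (fun t => X t ω) T - μ)))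
        atTop
        (fun ω => (2 * θ * √(FractionalVasicek.sigmaSq H θ) * N₂ ω /
            (μ + FractionalVasicek.zetaInf θ B (π ω)), (1 / θ) * N₁ ω))
        (fun _ => P) P' ∧
      TendstoInDistribution
        (fun (T : ℝ≥0) ω =>
          (Real.exp (θ * T) * (FractionalVasicek.thetaEst (fun t => X t ω) T - θ),
            (T : ℝ) ^ (1 - H) * (FractionalVasicek.alphaEst (fun t => X t ω) T - μ * θ)))
        atTop
        (fun ω => (2 * θ * √(FractionalVasicek.sigmaSq H θ) * N₂ ω /
            (μ + FractionalVasicek.zetaInf θ B (π ω)), N₁ ω))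
        (fun _ => P) P') := by
  obtain ⟨W, hW, hWB⟩ := hB.exists_regular hH
  have hx := hX.ae_isVasicekPath hθ hW hWB
  have hM := hW.ae_add_zetaPath_ne_zero hH hθ μ
  have hζ : HasLaw (FractionalVasicek.zetaInf θ B)
      (gaussianReal 0 (FractionalVasicek.sigmaSq H θ).toNNReal) P :=
    (hW.hasLaw_zetaPath hH hθ).congr
      ((FractionalVasicek.ae_zetaInf_eq hWB).mono fun _ h => h.symm)
  simp only [FractionalVasicek.thetaEst_eq, FractionalVasicek.alphaEst_eq,
    FractionalVasicek.muEst_eq]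
  refine ⟨?_, ?_, ?_, hζ, ?_⟩
  · filter_upwards [hx, hM] with ω h hne
    exact ((h.tendsto_thetaPath hne).prodMk_nhds (h.tendsto_muPath hne)).comp
      (NNReal.tendsto_coe_atTop.2 tendsto_id)
  · filter_upwards [hx, hM] with ω h hne
    exact ((h.tendsto_thetaPath hne).prodMk_nhds (h.tendsto_alphaPath hne)).comp
      (NNReal.tendsto_coe_atTop.2 tendsto_id)
  · filter_upwards [hWB] with ω h
    have := FractionalVasicek.integrableOn_exp_neg_mul_of_sublinear (hW.continuous ω)
      (hW.sublinear ω) hθ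
    simpa only [h] using this
  · intro Ω' _ P' _ π N₁ N₂ hπ h₁ h₂ h₁₂ hind
    have hindζ : IndepFun (fun ω => FractionalVasicek.zetaInf θ B (π ω))
        (fun ω => (N₁ ω, N₂ ω)) P' := FractionalVasicek.indepFun_zetaInf hθ hW hWB hπ hind
    have hζπ : HasLaw (fun ω => FractionalVasicek.zetaInf θ B (π ω))
        (gaussianReal 0 (FractionalVasicek.sigmaSq H θ).toNNReal) P' :=
      hζ.comp ⟨hπ.aemeasurable, hπ.map_eq⟩
    have hne : ∀ᵐ ω ∂P', μ + FractionalVasicek.zetaInf θ B (π ω) ≠ 0 := by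
      filter_upwards [hπ.quasiMeasurePreserving.ae hM,
        hπ.quasiMeasurePreserving.ae (FractionalVasicek.ae_zetaInf_eq (θ := θ) hWB)] with ω h1 h2
      rwa [← h2]
    have hT : ∀ T : ℝ≥0, (0 : ℝ) ≤ T := fun T => T.coe_nonneg
    have hth : ∀ T : ℝ≥0, AEMeasurable (fun ω => Real.exp (θ * T) *
        (FractionalVasicek.thetaPath (fun s => X s.toNNReal ω) T - θ)) P := fun T =>
      ((hW.aemeasurable_thetaPath hx (hT T)).sub_const θ).const_mul _
    have hlim : AEMeasurable (fun ω => 2 * θ * √(FractionalVasicek.sigmaSq H θ) * N₂ ω /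
        (μ + FractionalVasicek.zetaInf θ B (π ω))) P' :=
      (h₂.aemeasurable.const_mul _).div (hζπ.aemeasurable.const_add μ)
    refine ⟨FractionalVasicek.iIndepFun_vec_three h₁₂ hindζ, ?_, ?_⟩
    -- Sequences suffice, and along them the almost sure expansions become convergence in measure,
    -- as Slutsky needs.
    · refine FractionalVasicek.tendstoInDistribution_of_seq (fun T => (hth T).prodMk
        (((hW.aemeasurable_muPath hx (hT T)).sub_const μ).const_mul _))
        (hlim.prodMk (h₁.aemeasurable.const_mul _)) fun u hu => ?_
      refine hW.tendstoInDistribution_pair hx hH hθ hζπ h₁ h₂ h₁₂ hindζ hne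
        (u := fun n => (u n : ℝ)) (fun n => hT _) (NNReal.tendsto_coe_atTop.2 hu)
        (e := fun T ω => FractionalVasicek.muPath (fun s => X s.toNNReal ω) T)
        (fun T hT => hW.aemeasurable_muPath hx hT) (fun T hT => hW.aemeasurable_muFactor hx hT)
        (fun T hT => hW.aemeasurable_muOuFactor hx hH hθ hT) ?_
      filter_upwards [hx, hM] with ω h hne
      exact ⟨h.tendsto_muFactor hne, ⟨_, h.tendsto_muOuFactor hne⟩, h.tendsto_muPath_expansion hne⟩
    · refine FractionalVasicek.tendstoInDistribution_of_seq (fun T => (hth T).prodMk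
        (((hW.aemeasurable_alphaPath hx (hT T)).sub_const (μ * θ)).const_mul _))
        (hlim.prodMk h₁.aemeasurable) fun u hu => ?_
      -- The noise coefficient for `α` is `θ` times that for `μ`, so its limit is `θ * (1 / θ) = 1`.
      have key := hW.tendstoInDistribution_pair hx hH hθ hζπ h₁ h₂ h₁₂ hindζ hne (c := 1)
        (u := fun n => (u n : ℝ)) (fun n => hT _) (NNReal.tendsto_coe_atTop.2 hu)
        (e := fun T ω => FractionalVasicek.alphaPath (fun s => X s.toNNReal ω) T)
        (m := μ * θ)
        (fun T hT => hW.aemeasurable_alphaPath hx hT)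
        (fun T hT => (hW.aemeasurable_muFactor hx hT).const_mul θ)
        (fun T hT => (hW.aemeasurable_muOuFactor hx hH hθ hT).const_mul θ) ?_
      · simpa only [one_mul] using key
      · filter_upwards [hx, hM] with ω h hne
        refine ⟨?_, ⟨_, (h.tendsto_muOuFactor hne).const_mul θ⟩,
          h.tendsto_alphaPath_expansion hne⟩
        have := (h.tendsto_muFactor hne).const_mul θ
        rwa [mul_one_div_cancel hθ.ne'] at this
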